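/- Let $K$ be a field and $K\langle E_1,E_2\rangle$ the free associative algebra on $E_1,E_2$. Order the letters by $1\prec 2$ and words in $1,2$ lexicographically (a proper prefix is smaller). A nonempty word $\alpha$ is a Lyndon word if $\alpha=\beta\gamma\prec\gamma\beta$ for every factorization into nonempty words $\beta,\gamma$. Write $|\alpha|$ for its length and $\alpha(1),\alpha(2)$ for its numbers of letters $1$ and $2$. For letters, $E_\alpha$ is the corresponding generator; for a Lyndon word of length at least $2$ put $E_\alpha=[E_\beta,E_\gamma]=E_\beta E_\gamma-E_\gamma E_\beta$, where $\alpha=\beta\gamma$ with $\beta,\gamma$ Lyndon and $\gamma$ of maximal length. The monomials $E_{\alpha_1}^{m_1}\cdots E_{\alpha_s}^{m_s}$ with $\alpha_1\succ\cdots\succ\alpha_s$ Lyndon words, $m_i\ge 1$, $s\ge 0$, form a basis of $K\langle E_1,E_2\rangle$ (the Lyndon--Shirshov PBW basis). Let $\mathcal{SH}_{i,j}$ be the sum of all words in $E_1,E_2$ that contain $E_2$ exactly $i$ times and $E_1$ exactly $j$ times, and let $C_{E_\alpha}\in K$ be the coefficient of the basis element $E_\alpha$ in the expansion of $\mathcal{SH}_{\alpha(2),\alpha(1)}$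 in this basis. Define the Bell differential polynomials by $\widehat B_0=1$ and $\widehat B_{n+1}=[E_1,\widehat B_n]+E_2\widehat B_n$, and let $\widehat B_{n,k}$ be the homogeneous part of $\widehat B_n$ of degree $k$ in $E_2$ (so $\widehat B_{0,0}=1$). Then for all integers $n,k\ge 0$ $$\widehat B_{n,k}=\sum_{\substack{t_2+\sum_i t_{\alpha_i}\alpha_i(2)=k\\ \sum_i t_{\alpha_i}\alpha_i(1)=n-k}}\frac{n!}{t_2!\,t_{\alpha_1}!\cdots t_{\alpha_r}!}\,E_2^{t_2}\left(\frac{C_{E_{\alpha_1}}E_{\alpha_1}}{|\alpha_1|!}\right)^{t_{\alpha_1}}\cdots\left(\frac{C_{E_{\alpha_r}}E_{\alpha_r}}{|\alpha_r|!}\right)^{t_{\alpha_r}},$$ $$\widehat B_{n}=\sum_{t_2+\sum_i t_{\alpha_i}|\alpha_i|=n}\frac{n!}{t_2!\,t_{\alpha_1}!\cdots t_{\alpha_r}!}\,E_2^{t_2}\left(\frac{C_{E_{\alpha_1}}E_{\alpha_1}}{|\alpha_1|!}\right)^{t_{\alpha_1}}\cdots\left(\frac{C_{E_{\alpha_r}}E_{\alpha_r}}{|\alpha_r|!}\right)^{t_{\alpha_r}}.$$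 The sums run over all $t_2\ge 0$ and all finite families of Lyndon words $2\succ\alpha_1\succ\cdots\succ\alpha_r\succ 1$ ($r\ge 0$) with exponents $t_{\alpha_i}\ge 1$ subject to the displayed conditions. In every term the number $\dfrac{n!}{t_2!\prod_i t_{\alpha_i}!\,(|\alpha_i|!)^{t_{\alpha_i}}}$ is an integer. The formulas hold over every field when this factor is read as that integer, mapped to $K$; when $n!\neq 0$ in $K$ they also hold with all divisions performed in $K$. -/

import Mathlib

/-! Words over `X` are lists, ordered lexicographically (a proper prefix is smaller), which is the
order of Mathlib on `List X`. The two letters `1 ≺ 2` are the elements `0 < 1` of `Fin 2`. -/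

noncomputable section

namespace LyndonBell

/-- A Lyndon word: a nonempty word `w` such that `w = u v` with `u, v` nonempty implies
`u v ≺ v u`. Letters satisfy this vacuously. -/
def IsLyndon {X : Type*} [LinearOrder X] (w : List X) : Prop :=
  w ≠ [] ∧ ∀ u v : List X, u ≠ [] → v ≠ [] → w = u ++ v → w < v ++ u

/-- The set of Lyndon words, with the lexicographic order. -/
abbrev LyndonWord (X : Type*) [LinearOrder X] : Type _ := {w : List X // IsLyndon w}

/-- `(u, v)` is the standard factorization of `w`: both factors are Lyndon words, and the right
factor is as long as possible. -/
def IsStandardFactorization {X : Type*} [LinearOrder X] (w : List X) (p : List X × List X) : Prop :=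
  w = p.1 ++ p.2 ∧ IsLyndon p.1 ∧ IsLyndon p.2 ∧
    ∀ u v : List X, w = u ++ v → IsLyndon u → IsLyndon v → v.length ≤ p.2.length

open Classical in
/-- The bracketing `E_w` in the free algebra: `E_x = x` for a letter, and `E_w = [E_u, E_v]` when
`(u, v)` is the standard factorization of `w`. (Words that are not Lyndon are irrelevant.) -/
def lyndonBracket (K : Type*) [Field K] {X : Type*} [LinearOrder X] (w : List X) :
    FreeAlgebra K X :=
  match w with
  | [] => 0
  | [x] => FreeAlgebra.ι K x
  | x :: y :: l =>
    if h : ∃ p : List X × List X, IsStandardFactorization (x :: y :: l) p then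
      ⁅lyndonBracket K h.choose.1, lyndonBracket K h.choose.2⁆
    else 0
termination_by w.length
decreasing_by
  all_goals
    have hp := h.choose_spec
    have hl := congrArg List.length hp.1
    have h1 := List.length_pos_iff.mpr hp.2.1.1
    have h2 := List.length_pos_iff.mpr hp.2.2.1.1
    simp only [List.length_append, List.length_cons] at hl ⊢
    omega

/-- The ordered product `f(α₁)^{t(α₁)} ⋯ f(α_r)^{t(α_r)}` over the support
`α₁ ≻ α₂ ≻ ⋯ ≻ α_r` of `t`. -/
def orderedProd {X : Type*} [LinearOrder X] {A : Type*} [Monoid A]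
    (t : LyndonWord X →₀ ℕ) (f : LyndonWord X → A) : A :=
  ((t.support.sort (· ≥ ·)).map fun α => f α ^ t α).prod

/-- The PBW monomial `E_{α₁}^{t(α₁)} ⋯ E_{α_r}^{t(α_r)}`, `α₁ ≻ ⋯ ≻ α_r`. -/
def pbwMonomial (K : Type*) [Field K] {X : Type*} [LinearOrder X] (t : LyndonWord X →₀ ℕ) :
    FreeAlgebra K X :=
  orderedProd t fun α => lyndonBracket K α.1

/-- The free generator `E₁` of `K⟨E₁, E₂⟩`. -/
def gen₁ (K : Type*) [Field K] : FreeAlgebra K (Fin 2) := FreeAlgebra.ι K 0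

/-- The free generator `E₂` of `K⟨E₁, E₂⟩`. -/
def gen₂ (K : Type*) [Field K] : FreeAlgebra K (Fin 2) := FreeAlgebra.ι K 1

/-- The part of `a` that is homogeneous of degree `d` in `E₂`: the sum of the terms of `a`, in the
basis of words, whose word contains the letter `2` exactly `d` times. -/
def homogeneousPart (K : Type*) [Field K] (d : ℕ) (a : FreeAlgebra K (Fin 2)) :
    FreeAlgebra K (Fin 2) :=
  (FreeAlgebra.basisFreeMonoid K (Fin 2)).repr.symm
    (((FreeAlgebra.basisFreeMonoid K (Fin 2)).repr a).filter
      fun w => (FreeMonoid.toList w).count 1 = d)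

/-- The shuffle type polynomial `SH_{i,j}(E₂, E₁)`: the sum of the words in the expansion of
`(E₁ + E₂)^{i+j}` that contain `2` exactly `i` times (hence `1` exactly `j` times). -/
def shuffleType (K : Type*) [Field K] (i j : ℕ) : FreeAlgebra K (Fin 2) :=
  homogeneousPart K i ((gen₁ K + gen₂ K) ^ (i + j))

/-- The Bell differential polynomials in `y` with respect to `x`:
`B̂₀ = 1`, `B̂_{n+1} = [x, B̂_n] + y B̂_n`. -/
def bell {A : Type*} [Ring A] (x y : A) : ℕ → A
  | 0 => 1
  | n + 1 => ⁅x, bell x y n⁆ + y * bell x y n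

/-- The partial Bell differential polynomial `B̂_{n,k}(E₁, E₂)`: the part of `B̂_n(E₁, E₂)` that is
homogeneous of degree `k` in `E₂`. -/
def partialBell (K : Type*) [Field K] (n k : ℕ) : FreeAlgebra K (Fin 2) :=
  homogeneousPart K k (bell (gen₁ K) (gen₂ K) n)

/-- Given the PBW basis `b` of `K⟨E₁, E₂⟩`, the coefficient `C_{E_α}` of the basis element `E_α` in
the expansion of `SH_{α(2), α(1)}(E₂, E₁)`. -/
def coeffC {K : Type*} [Field K]
    (b : Module.Basis (LyndonWord (Fin 2) →₀ ℕ) K (FreeAlgebra K (Fin 2)))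
    (α : LyndonWord (Fin 2)) : K :=
  b.repr (shuffleType K (α.1.count 1) (α.1.count 0)) (Finsupp.single α 1)

/-- Only Lyndon words `α` with `2 ≻ α ≻ 1` occur in `t`. -/
def IsMiddle (t : LyndonWord (Fin 2) →₀ ℕ) : Prop :=
  ∀ α ∈ t.support, [0] < α.1 ∧ α.1 < [1]

theorem finite_index (n : ℕ) :
    {p : ℕ × (LyndonWord (Fin 2) →₀ ℕ) |
      IsMiddle p.2 ∧ p.1 + (p.2.sum fun α m => m * α.1.length) = n}.Finite := by
  have hW : {α : LyndonWord (Fin 2) | α.1.length ≤ n}.Finite :=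
    (List.finite_length_le (Fin 2) n).preimage Subtype.val_injective.injOn
  refine ((Set.finite_Iic n).prod
    (Finset.finsupp hW.toFinset fun _ => Finset.range (n + 1)).finite_toSet).subset ?_
  rintro ⟨a, t⟩ ⟨-, h⟩
  have key : ∀ α ∈ t.support, t α * α.1.length ≤ n := fun α hα =>
    (Finset.single_le_sum (f := fun α => t α * α.1.length) (fun _ _ => Nat.zero_le _) hα).trans
      ((Nat.le_add_left _ a).trans h.le)
  refine ⟨(Nat.le_add_right _ _).trans h.le, ?_⟩
  rw [Finset.mem_coe, Finset.mem_finsupp_iff]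
  refine ⟨fun α hα => ?_, fun α _ => ?_⟩
  · have h1 : 1 ≤ t α := Nat.one_le_iff_ne_zero.mpr (Finsupp.mem_support_iff.mp hα)
    simpa using (Nat.le_mul_of_pos_left _ h1).trans (key α hα)
  · rw [Finset.mem_range, Nat.lt_succ_iff]
    by_cases hα : α ∈ t.support
    · exact (Nat.le_mul_of_pos_right _ (List.length_pos_iff.mpr α.2.1)).trans (key α hα)
    · simp [Finsupp.notMem_support_iff.mp hα]

/-- The pairs `(t₂, t)`, `t = (t_α)` with `2 ≻ α ≻ 1`, such that `t₂ + ∑ t_α |α| = n`. -/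
def indexSet (n : ℕ) : Finset (ℕ × (LyndonWord (Fin 2) →₀ ℕ)) := (finite_index n).toFinset

/-- The pairs `(t₂, t)`, `t = (t_α)` with `2 ≻ α ≻ 1`, such that `t₂ + ∑ t_α α(2) = k` and
`∑ t_α α(1) = n - k`, that is `∑ t_α α(1) + k = n` (there are none if `k > n`). -/
def partialIndexSet (n k : ℕ) : Finset (ℕ × (LyndonWord (Fin 2) →₀ ℕ)) :=
  (indexSet n).filter fun p =>
    p.1 + (p.2.sum fun α m => m * α.1.count 1) = k ∧ (p.2.sum fun α m => m * α.1.count 0) + k = n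

/-- Membership in `partialIndexSet`: the condition on the total length that is built into
`indexSet n` is implied by the two others. -/
theorem mem_partialIndexSet (n k : ℕ) (p : ℕ × (LyndonWord (Fin 2) →₀ ℕ)) :
    p ∈ partialIndexSet n k ↔ IsMiddle p.2 ∧ p.1 + (p.2.sum fun α m => m * α.1.count 1) = k ∧
      (p.2.sum fun α m => m * α.1.count 0) + k = n := by
  have hlen : ∀ l : List (Fin 2), l.length = l.count 1 + l.count 0 := by
    intro l
    induction l with
    | nil => rfl
    | cons a l ih => fin_cases a <;> simp [ih] <;> omega
  have hsum : (p.2.sum fun α m => m * α.1.length) =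
      (p.2.sum fun α m => m * α.1.count 1) + p.2.sum fun α m => m * α.1.count 0 := by
    simp only [Finsupp.sum, ← Finset.sum_add_distrib, hlen, mul_add]
  simp only [partialIndexSet, indexSet, Finset.mem_filter, Set.Finite.mem_toFinset,
    Set.mem_ofPred_eq, hsum]
  constructor
  · rintro ⟨⟨h, -⟩, h'⟩
    exact ⟨h, h'⟩
  · rintro ⟨h, h1, h2⟩
    exact ⟨⟨h, by omega⟩, h1, h2⟩

/-- The product `t₂! ∏ (t_α! (|α|!)^{t_α})`. -/
def denom (p : ℕ × (LyndonWord (Fin 2) →₀ ℕ)) : ℕ :=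
  p.1.factorial * p.2.prod fun α m => m.factorial * α.1.length.factorial ^ m

/-- The term
`n! / (t₂! ∏ t_α!) · E₂^{t₂} (C_{E_{α₁}} E_{α₁} / |α₁|!)^{t_{α₁}} ⋯ (C_{E_{α_r}} E_{α_r} / |α_r|!)^{t_{α_r}}`
with `α₁ ≻ ⋯ ≻ α_r`, the divisions being those of the field `K`. -/
def fieldTerm {K : Type*} [Field K]
    (b : Module.Basis (LyndonWord (Fin 2) →₀ ℕ) K (FreeAlgebra K (Fin 2)))
    (n : ℕ) (p : ℕ × (LyndonWord (Fin 2) →₀ ℕ)) : FreeAlgebra K (Fin 2) :=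
  ((n.factorial : K) / ((p.1.factorial : K) * p.2.prod fun _ m => (m.factorial : K))) •
    (gen₂ K ^ p.1 *
      orderedProd p.2 fun α => (coeffC b α / (α.1.length.factorial : K)) • lyndonBracket K α.1)

/-- The same term with all numerical factors collected in the integer
`n! / (t₂! ∏ t_α! (|α|!)^{t_α})`, which makes sense in every characteristic. -/
def integralTerm {K : Type*} [Field K]
    (b : Module.Basis (LyndonWord (Fin 2) →₀ ℕ) K (FreeAlgebra K (Fin 2)))
    (n : ℕ) (p : ℕ × (LyndonWord (Fin 2) →₀ ℕ)) : FreeAlgebra K (Fin 2) :=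
  ((n.factorial / denom p : ℕ) : K) •
    (gen₂ K ^ p.1 * orderedProd p.2 fun α => coeffC b α • lyndonBracket K α.1)

end LyndonBell

end

/-! Put `s = E₁ + E₂`. Left multiplication by `s` is the sum of the operator `[E₁, ·] + E₂ ·` and of
right multiplication by `E₁`. These two commute, so applying the binomial theorem to `1` gives `s ^
n = ∑ (n choose m) B̂_m E₁ ^ (n - m)`. This system determines the `B̂_m`, and it suffices to show
that the right-hand sides of the theorem satisfy it (`sum_choose_bell_mul_pow`,
`eq_of_sum_choose_mul_pow_eq`).

For this, expand `s ^ n` in the PBW basis. With the coproduct that makes the generators primitive,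
`s` and all `E_α` are primitive. Hence the coproducts of `s ^ n` and of ordered monomials are given
by binomial coefficients. Comparing coefficients of `E_s ⊗ E_t` shows that the coefficients `c(t)`
are multiplicative up to factorials: `c(t) ∏ t_α! (|α|!)^{t_α} = |t|! ∏ c(α)^{t_α}`
(`powCoeff_mul_blockFactorial`). The product of factorials is cancelled over `ℤ` and the result
carried to `K`, which works in every characteristic (`powCoeff_eq`).

The letter `2` is the greatest Lyndon word and `1` the smallest, so every monomial begins with a
power of `E₂` and ends with a power of `E₁`. Collecting terms by the latter power yields the
required system (`sum_choose_integralTerm`). Since the `E_α` are homogeneous, `c(α) = C_{E_α}`, and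
taking degrees in `E₂` gives the partial polynomials.

The PBW basis itself comes from unique factorization into Lyndon words and from unitriangularity:
`E_w` is `w` plus greater words of the same length. -/

noncomputable section

namespace LyndonBell

/-! ### Lyndon words: suffixes, unique factorization, standard factorization. -/

section Words

variable {X : Type*} [LinearOrder X]

theorem append_lt_append_of_not_prefix {u v : List X} (h : u < v) (hp : ¬ u <+: v)
    (x y : List X) : u ++ x < v ++ y := by
  induction u generalizing v with
  | nil => exact absurd (List.nil_prefix) hp
  | cons a u ih =>
    cases v with
    | nil => exact absurd h (List.not_lt_nil _)
    | cons b v =>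
      rw [List.cons_append, List.cons_append, List.cons_lt_cons_iff]
      rcases List.cons_lt_cons_iff.1 h with h1 | ⟨rfl, h2⟩
      · exact Or.inl h1
      · exact Or.inr ⟨rfl, ih h2 fun hp' => hp ((List.prefix_cons_inj a).2 hp')⟩

theorem lt_append_of_ne_nil (u : List X) {v : List X} (hv : v ≠ []) : u < u ++ v := by
  have h : ([] : List X) < v := by
    cases v with
    | nil => exact absurd rfl hv
    | cons a l => exact List.nil_lt_cons a l
  simpa using List.append_left_lt (l₁ := u) h

theorem le_append (u v : List X) : u ≤ u ++ v := by
  by_cases hv : v = []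
  · simp [hv]
  · exact (lt_append_of_ne_nil u hv).le

theorem append_lt_append_iff_left (w : List X) {u v : List X} : w ++ u < w ++ v ↔ u < v := by
  refine ⟨fun h => ?_, fun h => List.append_left_lt h⟩
  rcases lt_trichotomy u v with h' | rfl | h'
  · exact h'
  · exact absurd h (lt_irrefl _)
  · exact absurd h (List.append_left_lt h').asymm

theorem not_prefix_of_lt_of_length_le {u v : List X} (h : u < v) (hl : v.length ≤ u.length) :
    ¬ u <+: v := by
  intro hp
  exact h.ne (hp.eq_of_length_le hl)

/-- For words of the same length, multiplication is strictly monotone. -/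
theorem append_lt_append_of_lt {u v : List X} (h : u < v) (hl : v.length = u.length)
    (x y : List X) : u ++ x < v ++ y :=
  append_lt_append_of_not_prefix h (not_prefix_of_lt_of_length_le h hl.le) x y

/-- Suppose `v < w`. If `v` is not a prefix of `w`, the comparison is decided inside `v`, so `vu <
w`, against `uv < vu`. If `w = vx`, then `vx = uv < vu` gives `x < u`, hence `xv < uv = vx`, against
the Lyndon condition for `w = vx`. -/
theorem IsLyndon.lt_suffix {w u v : List X} (h : IsLyndon w) (hu : u ≠ []) (hv : v ≠ [])
    (hw : w = u ++ v) : w < v := by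
  by_contra hlt
  have hvw : v < w := by
    refine lt_of_le_of_ne (not_lt.1 hlt) fun he => hu ?_
    rw [hw] at he
    exact List.eq_nil_of_length_eq_zero (by
      have := congrArg List.length he
      simp at this
      exact List.length_eq_zero_iff.2 this)
  have h1 := h.2 u v hu hv hw
  by_cases hp : v <+: w
  · obtain ⟨x, hx⟩ := hp
    have hxl : x.length = u.length := by
      have e1 := congrArg List.length hx
      have e2 := congrArg List.length hw
      simp at e1 e2
      omega
    have hx0 : x ≠ [] := by
      intro h0
      rw [h0] at hxl
      exact hu (List.eq_nil_of_length_eq_zero hxl.symm)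
    have h2 := h.2 v x hv hx0 hx.symm
    have h3 : x < u := by
      rw [← append_lt_append_iff_left v, hx]
      exact h1
    have h4 : x ++ v < u ++ v := append_lt_append_of_lt h3 hxl.symm v v
    rw [← hw] at h4
    exact h4.asymm h2
  · have := append_lt_append_of_not_prefix hvw hp u []
    rw [List.append_nil] at this
    exact this.asymm h1

theorem isLyndon_of_lt_suffix {w : List X} (h0 : w ≠ [])
    (h : ∀ u v : List X, u ≠ [] → v ≠ [] → w = u ++ v → w < v) : IsLyndon w :=
  ⟨h0, fun u v hu hv hw => (h u v hu hv hw).trans_le (le_append v u)⟩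

theorem isLyndon_singleton (x : X) : IsLyndon [x] := by
  refine ⟨by simp, fun u v hu hv h => ?_⟩
  have := congrArg List.length h
  have := List.length_pos_iff.2 hu
  have := List.length_pos_iff.2 hv
  simp at *
  omega

/-- The key inequality is `uv < v`; when `v = ux` it follows from `v < x`. A proper suffix of `uv`
is a suffix of `v`, hence at least `v`, or has the form `cv` with `c` a proper suffix of `u`; in
that case `u < c` is decided before `c` ends. -/
theorem IsLyndon.append {u v : List X} (hu : IsLyndon u) (hv : IsLyndon v) (h : u < v) :
    IsLyndon (u ++ v) := by
  have hlt : u ++ v < v := by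
    by_cases hp : u <+: v
    · obtain ⟨x, rfl⟩ := hp
      have hx : x ≠ [] := by
        rintro rfl
        simp at h
      exact List.append_left_lt (hv.lt_suffix hu.1 hx rfl)
    · simpa using append_lt_append_of_not_prefix h hp v []
  refine isLyndon_of_lt_suffix (by simp [hu.1]) fun a b ha hb hab => ?_
  rcases List.append_eq_append_iff.1 hab with ⟨c, h1, h2⟩ | ⟨c, h1, h2⟩
  · by_cases hc : c = []
    · subst hc
      simp only [List.nil_append] at h2
      rwa [← h2]
    · exact hlt.trans (hv.lt_suffix hc hb h2)
  · by_cases hc : c = []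
    · subst hc
      simp only [List.nil_append] at h2
      rwa [h2]
    · rw [h2]
      have hlt' := hu.lt_suffix ha hc h1
      refine append_lt_append_of_not_prefix hlt' (not_prefix_of_lt_of_length_le hlt' ?_) v v
      rw [h1]
      simp

/-- A nonincreasing list of Lyndon words. -/
def IsLyndonList (l : List (List X)) : Prop :=
  (∀ w ∈ l, IsLyndon w) ∧ l.Pairwise (· ≥ ·)

theorem IsLyndonList.of_cons {a : List X} {l : List (List X)} (h : IsLyndonList (a :: l)) :
    IsLyndonList l :=
  ⟨fun w hw => h.1 w (List.mem_cons_of_mem _ hw), (List.pairwise_cons.1 h.2).2⟩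

/-- The new word absorbs the head of the list as long as it is smaller than that head. If everything
collapses to one word, the last merge exhibits this word as a product of two Lyndon words; the last
clause records this for `IsLyndon.exists_append`. -/
theorem exists_isLyndonList_insert {u : List X} (hu : IsLyndon u) {l : List (List X)}
    (hl : IsLyndonList l) :
    ∃ m, IsLyndonList m ∧ m.flatten = u ++ l.flatten ∧
      (l ≠ [] → ∀ w, m = [w] → ∃ a b, IsLyndon a ∧ IsLyndon b ∧ w = a ++ b) := by
  induction l generalizing u with
  | nil => exact ⟨[u], ⟨by simpa using hu, by simp⟩, by simp, fun h => absurd rfl h⟩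
  | cons v l ih =>
    have hv : IsLyndon v := hl.1 v (by simp)
    by_cases h : u < v
    · obtain ⟨m, hm, hf, hs⟩ := ih (hu.append hv h) hl.of_cons
      refine ⟨m, hm, by simp [hf], fun _ w hw => ?_⟩
      by_cases hl0 : l = []
      · refine ⟨u, v, hu, hv, ?_⟩
        simpa [hl0, hw] using hf
      · exact hs hl0 w hw
    · refine ⟨u :: v :: l, ⟨?_, ?_⟩, by simp, fun _ w hw => by simp at hw⟩
      · intro w hw
        rcases List.mem_cons.1 hw with rfl | hw
        · exact hu
        · exact hl.1 w hw
      · refine List.pairwise_cons.2 ⟨fun w hw => ?_, hl.2⟩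
        rcases List.mem_cons.1 hw with rfl | hw
        · exact not_lt.1 h
        · exact ((List.pairwise_cons.1 hl.2).1 w hw).trans (not_lt.1 h)

theorem exists_isLyndonList (w : List X) :
    ∃ m, IsLyndonList m ∧ m.flatten = w ∧
      (2 ≤ w.length → m = [w] → ∃ a b, IsLyndon a ∧ IsLyndon b ∧ w = a ++ b) := by
  cases w with
  | nil => exact ⟨[], ⟨by simp, by simp⟩, rfl, by simp⟩
  | cons x w =>
    obtain ⟨l, hl, hf, -⟩ := exists_isLyndonList w
    obtain ⟨m, hm, hmf, hs⟩ := exists_isLyndonList_insert (isLyndon_singleton x) hl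
    refine ⟨m, hm, by simp [hmf, hf], fun h2 => hs ?_ _⟩
    rintro rfl
    obtain rfl : [] = w := by simpa using hf
    simp at h2

/-- The word `r` ends inside some factor of `l`, and the piece of `r` in that factor is a prefix of
it. -/
theorem exists_suffix_le_of_prefix_flatten {b : List X} {l : List (List X)} (hl : ∀ w ∈ l, w ≤ b)
    {r : List X} (hr : r ≠ []) (hp : r <+: l.flatten) : ∃ p, p ≠ [] ∧ p <:+ r ∧ p ≤ b := by
  induction l generalizing r with
  | nil => simp at hp; exact absurd hp hr
  | cons v l ih =>
    obtain ⟨x, hx⟩ := hp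
    rw [List.flatten_cons] at hx
    rcases List.append_eq_append_iff.1 hx with ⟨c, h1, h2⟩ | ⟨c, h1, h2⟩
    · exact ⟨r, hr, List.suffix_rfl, (le_append r c).trans (h1 ▸ hl v (by simp))⟩
    · by_cases hc : c = []
      · refine ⟨r, hr, List.suffix_rfl, ?_⟩
        rw [h1, hc, List.append_nil]
        exact hl v (by simp)
      · obtain ⟨p, hp0, hp, hpb⟩ := ih (fun w hw => hl w (List.mem_cons_of_mem _ hw)) hc ⟨x, h2.symm⟩
        exact ⟨p, hp0, hp.trans ⟨v, h1.symm⟩, hpb⟩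

/-- If `m` reached beyond `a`, it would have a proper suffix `p ≤ a ≤ m`, whereas a Lyndon word is
smaller than its proper suffixes. So the first factor is the longest Lyndon prefix, which forces
uniqueness of the factorization. -/
theorem IsLyndonList.prefix_of_prefix_flatten {a m : List X} {l : List (List X)}
    (hl : IsLyndonList (a :: l)) (hm : IsLyndon m) (hp : m <+: (a :: l).flatten) : m <+: a := by
  obtain ⟨x, hx⟩ := hp
  rw [List.flatten_cons] at hx
  rcases List.append_eq_append_iff.1 hx with ⟨c, h1, h2⟩ | ⟨c, h1, h2⟩
  · exact ⟨c, h1.symm⟩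
  · by_cases hc : c = []
    · rw [h1, hc, List.append_nil]
    · obtain ⟨p, hp0, ⟨q, rfl⟩, hpb⟩ := exists_suffix_le_of_prefix_flatten
        (List.pairwise_cons.1 hl.2).1 hc ⟨x, h2.symm⟩
      have ha : a ≠ [] := (hl.1 a (by simp)).1
      have hlt : m < p := hm.lt_suffix (u := a ++ q) (by simp [ha]) hp0 (by simp [h1])
      have : a ≤ m := h1 ▸ le_append a _
      exact absurd (hlt.trans_le (hpb.trans this)) (lt_irrefl _)

theorem IsLyndonList.flatten_injective {l m : List (List X)} (hl : IsLyndonList l)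
    (hm : IsLyndonList m) (h : l.flatten = m.flatten) : l = m := by
  induction l generalizing m with
  | nil =>
    cases m with
    | nil => rfl
    | cons b m =>
      simp only [List.flatten_nil, List.flatten_cons] at h
      exact absurd (List.append_eq_nil_iff.1 h.symm).1 (hm.1 b (by simp)).1
  | cons a l ih =>
    cases m with
    | nil =>
      simp only [List.flatten_nil, List.flatten_cons] at h
      exact absurd (List.append_eq_nil_iff.1 h).1 (hl.1 a (by simp)).1
    | cons b m =>
      have h1 : a <+: b := hm.prefix_of_prefix_flatten (hl.1 a (by simp)) ⟨l.flatten, by rw [← h]; simp⟩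
      have h2 : b <+: a := hl.prefix_of_prefix_flatten (hm.1 b (by simp)) ⟨m.flatten, by rw [h]; simp⟩
      obtain rfl : a = b := h1.eq_of_length_le h2.length_le
      rw [ih hl.of_cons hm.of_cons (by simpa using h)]

/-- By uniqueness, the insertion procedure applied to `w` must return `[w]`, and its last merge
gives the two factors. -/
theorem IsLyndon.exists_append {w : List X} (hw : IsLyndon w) (h : 2 ≤ w.length) :
    ∃ a b, IsLyndon a ∧ IsLyndon b ∧ w = a ++ b := by
  obtain ⟨m, hm, hf, hs⟩ := exists_isLyndonList w
  exact hs h (hm.flatten_injective (m := [w]) ⟨by simpa using hw, by simp⟩ (by simpa using hf))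

theorem IsLyndon.exists_isStandardFactorization {w : List X} (hw : IsLyndon w)
    (h : 2 ≤ w.length) : ∃ p, IsStandardFactorization w p := by
  classical
  let P : ℕ → Prop := fun n => ∃ a b, IsLyndon a ∧ IsLyndon b ∧ w = a ++ b ∧ b.length = n
  have hP : ∃ n, P n := by
    obtain ⟨a, b, ha, hb, hab⟩ := hw.exists_append h
    exact ⟨_, a, b, ha, hb, hab, rfl⟩
  have hb : ∀ n, P n → n ≤ w.length := by
    rintro n ⟨a, b, -, -, rfl, rfl⟩
    simp
  obtain ⟨n, hn⟩ := hP
  obtain ⟨a, b, ha, hb', hab, hlen⟩ := Nat.findGreatest_spec (hb n hn) hn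
  refine ⟨(a, b), hab, ha, hb', fun u v huv hu hv => ?_⟩
  have hv' : P v.length := ⟨u, v, hu, hv, huv, rfl⟩
  exact hlen ▸ Nat.le_findGreatest (hb _ hv') hv'

end Words

/-! ### Products over Lyndon words in decreasing order. -/

section OrderedProducts

variable {X : Type*} [LinearOrder X] {A : Type*} [Monoid A]

@[simp]
theorem orderedProd_zero (f : LyndonWord X → A) : orderedProd 0 f = 1 := by
  simp [orderedProd]

theorem orderedProd_single_add_of_lt {t : LyndonWord X →₀ ℕ} {α : LyndonWord X}
    (h : ∀ β ∈ t.support, β < α) (m : ℕ) (f : LyndonWord X → A) :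
    orderedProd (Finsupp.single α m + t) f = f α ^ m * orderedProd t f := by
  classical
  rcases eq_or_ne m 0 with rfl | hm
  · simp
  have hα : α ∉ t.support := fun hα => (h α hα).false
  have hsupp : (Finsupp.single α m + t).support = insert α t.support := by
    rw [Finsupp.support_add_eq (by simpa [Finsupp.support_single _ hm] using hα),
      Finsupp.support_single _ hm]
    rfl
  unfold orderedProd
  rw [hsupp, Finset.sort_insert _ (fun b hb => (h b hb).le) hα, List.map_cons, List.prod_cons]
  congr 1
  · simp [Finsupp.notMem_support_iff.1 hα]
  · refine congrArg List.prod (List.map_congr_left fun β hβ => ?_)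
    have hne : α ≠ β := (h β ((Finset.mem_sort _).1 hβ)).ne'
    simp [Finsupp.single_eq_of_ne hne.symm]

theorem orderedProd_single (α : LyndonWord X) (m : ℕ) (f : LyndonWord X → A) :
    orderedProd (Finsupp.single α m) f = f α ^ m := by
  simpa using orderedProd_single_add_of_lt (t := 0) (α := α) (by simp) m f

theorem orderedProd_single_add_of_le {t : LyndonWord X →₀ ℕ} {α : LyndonWord X}
    (h : ∀ β ∈ t.support, β ≤ α) (m : ℕ) (f : LyndonWord X → A) :
    orderedProd (Finsupp.single α m + t) f = f α ^ m * orderedProd t f := by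
  have h' : ∀ β ∈ (t.erase α).support, β < α := fun β hβ => by
    rw [Finsupp.support_erase, Finset.mem_erase] at hβ
    exact lt_of_le_of_ne (h β hβ.2) hβ.1
  conv_lhs => rw [← Finsupp.single_add_erase α t, ← add_assoc, ← Finsupp.single_add,
    orderedProd_single_add_of_lt h', pow_add, mul_assoc]
  conv_rhs => rw [← Finsupp.single_add_erase α t, orderedProd_single_add_of_lt h']

theorem mem_support_single_add {t : LyndonWord X →₀ ℕ} {α β : LyndonWord X} {m : ℕ}
    (h : β ∈ (Finsupp.single α m + t).support) : β = α ∨ β ∈ t.support := by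
  classical
  rcases Finset.mem_union.1 (Finsupp.support_add h) with h | h
  · exact Or.inl (Finset.mem_singleton.1 (Finsupp.support_single_subset h))
  · exact Or.inr h

theorem orderedProd_add_single_of_lt {t : LyndonWord X →₀ ℕ} {α : LyndonWord X}
    (h : ∀ β ∈ t.support, α < β) (m : ℕ) (f : LyndonWord X → A) :
    orderedProd (t + Finsupp.single α m) f = orderedProd t f * f α ^ m := by
  induction t using Finsupp.induction_on_max with
  | zero => simp [orderedProd_single]
  | single_add β k t hβ hk ih =>
    have hmem : β ∈ (Finsupp.single β k + t).support := by
      simp only [Finsupp.mem_support_iff, Finsupp.add_apply, Finsupp.single_eq_same]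
      omega
    have hsub : ∀ γ ∈ t.support, γ ∈ (Finsupp.single β k + t).support := fun γ hγ => by
      simp only [Finsupp.mem_support_iff, Finsupp.add_apply] at hγ ⊢
      omega
    rw [add_assoc, orderedProd_single_add_of_lt, ih fun γ hγ => h γ (hsub γ hγ),
      orderedProd_single_add_of_lt hβ, mul_assoc]
    intro γ hγ
    rw [add_comm] at hγ
    rcases mem_support_single_add hγ with rfl | hγ
    · exact h β hmem
    · exact hβ γ hγ

theorem map_orderedProd {B F : Type*} [Monoid B] [FunLike F A B] [MonoidHomClass F A B] (φ : F)
    (t : LyndonWord X →₀ ℕ) (f : LyndonWord X → A) :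
    φ (orderedProd t f) = orderedProd t fun α => φ (f α) := by
  simp [orderedProd, map_list_prod, Function.comp_def]

theorem orderedProd_smul {R A : Type*} [CommSemiring R] [Semiring A] [Algebra R A]
    (c : LyndonWord X → R) (t : LyndonWord X →₀ ℕ) (f : LyndonWord X → A) :
    (orderedProd t fun α => c α • f α) = (t.prod fun α m => c α ^ m) • orderedProd t f := by
  induction t using Finsupp.induction_on_max with
  | zero => simp
  | single_add β k t hβ hk ih =>
    have hd : Disjoint (Finsupp.single β k).support t.support := by
      rw [Finsupp.support_single _ hk, Finset.disjoint_singleton_left]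
      exact fun hm => (hβ β hm).false
    rw [orderedProd_single_add_of_lt hβ, ih, Finsupp.prod_add_index_of_disjoint hd,
      Finsupp.prod_single_index (h := fun α m => c α ^ m) (pow_zero _),
      orderedProd_single_add_of_lt hβ, smul_pow,
      smul_mul_smul_comm]

end OrderedProducts

theorem toList_ofList_pow {X : Type*} (w : List X) (m : ℕ) :
    FreeMonoid.toList (FreeMonoid.ofList w ^ m) = (List.replicate m w).flatten := by
  induction m with
  | zero => simp
  | succ m ih => rw [pow_succ', FreeMonoid.toList_mul, ih, List.replicate_succ]; rfl

/-! ### Words as families of multiplicities of Lyndon words. -/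

section Factorization

variable {X : Type*} [LinearOrder X]

/-- The word `α₁^{t(α₁)} ⋯ α_r^{t(α_r)}`, `α₁ ≻ ⋯ ≻ α_r`. -/
def lyndonProd (t : LyndonWord X →₀ ℕ) : List X :=
  FreeMonoid.toList (orderedProd t fun α => FreeMonoid.ofList α.1)

theorem lyndonProd_zero : lyndonProd (0 : LyndonWord X →₀ ℕ) = [] := by
  simp [lyndonProd]

theorem lyndonProd_single_add {t : LyndonWord X →₀ ℕ} {α : LyndonWord X}
    (h : ∀ β ∈ t.support, β ≤ α) (m : ℕ) :
    lyndonProd (Finsupp.single α m + t) = (List.replicate m α.1).flatten ++ lyndonProd t := by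
  rw [lyndonProd, orderedProd_single_add_of_le h, FreeMonoid.toList_mul, toList_ofList_pow]
  rfl

/-- Passes from multiplicities to nonincreasing lists; since `t` can be read off by counting,
uniqueness for lists makes `lyndonProd` injective. -/
theorem exists_isLyndonList_count (t : LyndonWord X →₀ ℕ) :
    ∃ l, IsLyndonList l ∧ l.flatten = lyndonProd t ∧ (∀ α : LyndonWord X, l.count α.1 = t α) ∧
      ∀ w ∈ l, ∃ α ∈ t.support, α.1 = w := by
  induction t using Finsupp.induction_on_max with
  | zero => exact ⟨[], ⟨by simp, by simp⟩, by simp [lyndonProd_zero], by simp, by simp⟩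
  | single_add β k t hβ hk ih =>
    obtain ⟨l, hl, hf, hc, hs⟩ := ih
    refine ⟨List.replicate k β.1 ++ l, ⟨?_, ?_⟩, ?_, ?_, ?_⟩
    · intro w hw
      rcases List.mem_append.1 hw with hw | hw
      · rw [List.eq_of_mem_replicate hw]
        exact β.2
      · exact hl.1 w hw
    · refine List.pairwise_append.2 ⟨List.pairwise_replicate.2 (Or.inr le_rfl), hl.2, ?_⟩
      intro a ha b hb
      rw [List.eq_of_mem_replicate ha]
      obtain ⟨γ, hγ, rfl⟩ := hs b hb
      exact (hβ γ hγ).le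
    · rw [lyndonProd_single_add fun γ hγ => (hβ γ hγ).le, List.flatten_append, hf]
    · intro α
      rw [List.count_append, hc, List.count_replicate, Finsupp.add_apply, Finsupp.single_apply]
      simp [Subtype.ext_iff]
    · intro w hw
      rcases List.mem_append.1 hw with hw | hw
      · refine ⟨β, ?_, (List.eq_of_mem_replicate hw).symm⟩
        simp only [Finsupp.mem_support_iff, Finsupp.add_apply, Finsupp.single_eq_same]
        omega
      · obtain ⟨γ, hγ, rfl⟩ := hs w hw
        refine ⟨γ, ?_, rfl⟩
        simp only [Finsupp.mem_support_iff, Finsupp.add_apply] at hγ ⊢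
        omega

theorem lyndonProd_injective : Function.Injective (lyndonProd (X := X)) := by
  intro s t h
  obtain ⟨l, hl, hlf, hlc, -⟩ := exists_isLyndonList_count s
  obtain ⟨m, hm, hmf, hmc, -⟩ := exists_isLyndonList_count t
  obtain rfl := hl.flatten_injective hm (by rw [hlf, hmf, h])
  ext α
  rw [← hlc, ← hmc]

theorem IsLyndonList.exists_lyndonProd_eq {l : List (List X)} (hl : IsLyndonList l) :
    ∃ t : LyndonWord X →₀ ℕ, lyndonProd t = l.flatten ∧ ∀ α ∈ t.support, α.1 ∈ l := by
  induction l with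
  | nil => exact ⟨0, by simp [lyndonProd_zero], by simp⟩
  | cons a l ih =>
    obtain ⟨t, ht, hs⟩ := ih hl.of_cons
    let α : LyndonWord X := ⟨a, hl.1 a (by simp)⟩
    refine ⟨Finsupp.single α 1 + t, ?_, fun β hβ => ?_⟩
    · rw [lyndonProd_single_add fun β hβ => (List.pairwise_cons.1 hl.2).1 _ (hs β hβ), ht]
      simp [α]
    · rcases mem_support_single_add hβ with rfl | hβ
      · exact List.mem_cons_self
      · exact List.mem_cons_of_mem _ (hs β hβ)

/-- Every word is a nonincreasing product of Lyndon words in exactly one way. -/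
theorem lyndonProd_bijective : Function.Bijective (lyndonProd (X := X)) := by
  refine ⟨lyndonProd_injective, fun w => ?_⟩
  obtain ⟨l, hl, rfl, -⟩ := exists_isLyndonList w
  obtain ⟨t, ht, -⟩ := hl.exists_lyndonProd_eq
  exact ⟨t, ht⟩

end Factorization

/-! ### Leading words and unitriangular families. -/

section Triangular

variable (R : Type*) [CommRing R] {X : Type*}

/-- The noncommutative monomial of a word. -/
def word (w : List X) : FreeAlgebra R X := FreeAlgebra.basisFreeMonoid R X (FreeMonoid.ofList w)

theorem word_eq_prod (w : List X) : word R w = (w.map (FreeAlgebra.ι R)).prod := by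
  have h : word R w = FreeMonoid.lift (FreeAlgebra.ι R) (FreeMonoid.ofList w) := by
    simp [word, FreeAlgebra.basisFreeMonoid, FreeAlgebra.equivMonoidAlgebraFreeMonoid]
  rw [h, FreeMonoid.lift_apply, FreeMonoid.toList_ofList]

theorem word_nil : word R ([] : List X) = 1 := by simp [word_eq_prod]

theorem word_singleton (x : X) : word R [x] = FreeAlgebra.ι R x := by simp [word_eq_prod]

theorem word_append (u v : List X) : word R (u ++ v) = word R u * word R v := by
  simp [word_eq_prod]

theorem repr_word (w : List X) :
    (FreeAlgebra.basisFreeMonoid R X).repr (word R w) = Finsupp.single (FreeMonoid.ofList w) 1 :=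
  Module.Basis.repr_self _ _

theorem span_range_word : Submodule.span R (Set.range (word R (X := X))) = ⊤ :=
  (FreeAlgebra.basisFreeMonoid R X).span_eq

/-- The span of the words in a set. -/
def wordSpan (S : Set (List X)) : Submodule R (FreeAlgebra R X) := Submodule.span R (word R '' S)

variable {R}

theorem word_mem_wordSpan {S : Set (List X)} {w : List X} (h : w ∈ S) : word R w ∈ wordSpan R S :=
  Submodule.subset_span ⟨w, h, rfl⟩

theorem wordSpan_mono {S T : Set (List X)} (h : S ⊆ T) : wordSpan R S ≤ wordSpan R T :=
  Submodule.span_mono (Set.image_mono h)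

theorem mul_mem_wordSpan {S T U : Set (List X)} (h : ∀ u ∈ S, ∀ v ∈ T, u ++ v ∈ U)
    {a b : FreeAlgebra R X} (ha : a ∈ wordSpan R S) (hb : b ∈ wordSpan R T) :
    a * b ∈ wordSpan R U := by
  have hab := Submodule.mul_mem_mul ha hb
  rw [wordSpan, wordSpan, Submodule.span_mul_span] at hab
  refine Submodule.span_mono ?_ hab
  rintro _ ⟨_, ⟨u, hu, rfl⟩, _, ⟨v, hv, rfl⟩, rfl⟩
  exact ⟨u ++ v, h u hu v hv, word_append R u v⟩

theorem repr_eq_zero_of_mem_wordSpan {S : Set (List X)} {a : FreeAlgebra R X}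
    (ha : a ∈ wordSpan R S) {w : List X} (hw : w ∉ S) :
    (FreeAlgebra.basisFreeMonoid R X).repr a (FreeMonoid.ofList w) = 0 := by
  induction ha using Submodule.span_induction with
  | mem x hx =>
    obtain ⟨v, hv, rfl⟩ := hx
    rw [repr_word, Finsupp.single_eq_of_ne]
    intro h
    exact hw ((FreeMonoid.ofList.injective h) ▸ hv)
  | zero => simp
  | add x y _ _ hx hy => simp [hx, hy]
  | smul c x _ hx => simp [hx]

variable [LinearOrder X]

/-- `a` is the sum of the word `w` and of a combination of greater words of the same length. -/
def HasLeadingWord (a : FreeAlgebra R X) (w : List X) : Prop :=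
  a - word R w ∈ wordSpan R {v | v.length = w.length ∧ w < v}

theorem HasLeadingWord.mem {a : FreeAlgebra R X} {w : List X} (h : HasLeadingWord a w) :
    a ∈ wordSpan R {v | v.length = w.length ∧ w ≤ v} := by
  have h1 := add_mem
    (wordSpan_mono (fun v hv => ⟨hv.1, hv.2.le⟩ : _ ⊆ {v | v.length = w.length ∧ w ≤ v}) h)
    (word_mem_wordSpan (R := R) (S := {v | v.length = w.length ∧ w ≤ v}) ⟨rfl, le_rfl⟩)
  rwa [sub_add_cancel] at h1

theorem hasLeadingWord_word (w : List X) : HasLeadingWord (word R w) w := by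
  simp [HasLeadingWord]

theorem HasLeadingWord.mul {a b : FreeAlgebra R X} {u v : List X} (ha : HasLeadingWord a u)
    (hb : HasLeadingWord b v) : HasLeadingWord (a * b) (u ++ v) := by
  have h : a * b - word R (u ++ v) = (a - word R u) * b + word R u * (b - word R v) := by
    rw [word_append]
    noncomm_ring
  rw [HasLeadingWord, h]
  refine add_mem (mul_mem_wordSpan ?_ ha hb.mem)
    (mul_mem_wordSpan ?_ (word_mem_wordSpan (S := {u}) rfl) hb)
  · rintro x ⟨hx, hux⟩ y ⟨hy, hvy⟩
    exact ⟨by simp [hx, hy], append_lt_append_of_lt hux hx v y⟩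
  · rintro x rfl y ⟨hy, hvy⟩
    exact ⟨by simp [hy], List.append_left_lt hvy⟩

/-- All words of `b * a` are at least `vu`, hence greater than `uv`, and do not disturb the leading
word of `a * b`. -/
theorem HasLeadingWord.lie {a b : FreeAlgebra R X} {u v : List X} (ha : HasLeadingWord a u)
    (hb : HasLeadingWord b v) (h : u ++ v < v ++ u) : HasLeadingWord ⁅a, b⁆ (u ++ v) := by
  have h1 := ha.mul hb
  have h2 := (hb.mul ha).mem
  rw [HasLeadingWord, Ring.lie_def, sub_right_comm]
  refine sub_mem h1 (wordSpan_mono ?_ h2)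
  rintro w ⟨hw, hle⟩
  exact ⟨by simp [hw, add_comm], h.trans_le hle⟩

theorem HasLeadingWord.pow {a : FreeAlgebra R X} {w : List X} (ha : HasLeadingWord a w) (m : ℕ) :
    HasLeadingWord (a ^ m) (List.replicate m w).flatten := by
  induction m with
  | zero => simpa [word_nil] using hasLeadingWord_word (R := R) ([] : List X)
  | succ m ih =>
    rw [pow_succ', List.replicate_succ, List.flatten_cons]
    exact ha.mul ih

theorem HasLeadingWord.orderedProd {f : LyndonWord X → FreeAlgebra R X}
    (hf : ∀ α : LyndonWord X, HasLeadingWord (f α) α.1) (t : LyndonWord X →₀ ℕ) :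
    HasLeadingWord (orderedProd t f) (lyndonProd t) := by
  induction t using Finsupp.induction_on_max with
  | zero => simpa [lyndonProd_zero, word_nil] using hasLeadingWord_word (R := R) ([] : List X)
  | single_add β k t hβ hk ih =>
    rw [orderedProd_single_add_of_lt hβ, lyndonProd_single_add fun γ hγ => (hβ γ hγ).le]
    exact ((hf β).pow k).mul ih

theorem HasLeadingWord.repr_eq {a : FreeAlgebra R X} {v w : List X} (h : HasLeadingWord a v)
    (hw : w ≤ v) : (FreeAlgebra.basisFreeMonoid R X).repr a (FreeMonoid.ofList w) =
      if v = w then 1 else 0 := by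
  classical
  have h1 := repr_eq_zero_of_mem_wordSpan h (w := w) fun h' => absurd h'.2 (not_lt.2 hw)
  rw [map_sub, Finsupp.sub_apply, sub_eq_zero, repr_word, Finsupp.single_apply] at h1
  rw [h1]
  simp

/-- In a relation, the smallest word `w` of the support occurs only in `f w`, with coefficient `1`.
-/
theorem linearIndependent_of_hasLeadingWord {f : List X → FreeAlgebra R X}
    (hf : ∀ w, HasLeadingWord (f w) w) : LinearIndependent R f := by
  rw [linearIndependent_iff]
  intro l hl
  by_contra hne
  obtain ⟨w, hw, hmin⟩ := l.support.exists_min_image id (Finsupp.support_nonempty_iff.2 hne)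
  have h := congrArg (fun a => (FreeAlgebra.basisFreeMonoid R X).repr a (FreeMonoid.ofList w)) hl
  simp only [Finsupp.linearCombination_apply, Finsupp.sum, map_sum, map_smul, map_zero,
    Finsupp.finsetSum_apply, Finsupp.smul_apply, Finsupp.zero_apply] at h
  rw [Finset.sum_eq_single w] at h
  · rw [(hf w).repr_eq le_rfl, if_pos rfl, smul_eq_mul, mul_one] at h
    exact Finsupp.mem_support_iff.1 hw h
  · intro v hv hvw
    rw [(hf v).repr_eq (w := w) (hmin v hv), if_neg hvw, smul_zero]
  · intro h'
    exact absurd hw h'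

/-- Over a finite alphabet only finitely many words of a given length exceed `w`; the induction is
on their number. -/
theorem span_range_eq_top_of_hasLeadingWord [Finite X] {f : List X → FreeAlgebra R X}
    (hf : ∀ w, HasLeadingWord (f w) w) : Submodule.span R (Set.range f) = ⊤ := by
  have hfin : ∀ w : List X, {v : List X | v.length = w.length ∧ w < v}.Finite := fun w =>
    (List.finite_length_eq X w.length).subset fun v hv => hv.1
  have key : ∀ (n : ℕ) (w : List X), {v : List X | v.length = w.length ∧ w < v}.ncard = n →
      word R w ∈ Submodule.span R (Set.range f) := by
    intro n
    induction n using Nat.strong_induction_on with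
    | _ n ih =>
      intro w hw
      have h1 : wordSpan R {v | v.length = w.length ∧ w < v} ≤ Submodule.span R (Set.range f) := by
        refine Submodule.span_le.2 ?_
        rintro _ ⟨v, ⟨hv, hlt⟩, rfl⟩
        refine ih _ ?_ v rfl
        rw [← hw]
        refine Set.ncard_lt_ncard ⟨?_, fun hsub => ?_⟩ (hfin w)
        · rintro x ⟨hx, hvx⟩
          exact ⟨hx.trans hv, hlt.trans hvx⟩
        · exact (hsub ⟨hv, hlt⟩).2.false
      have h2 := sub_mem (Submodule.subset_span ⟨w, rfl⟩ : f w ∈ Submodule.span R (Set.range f))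
        (h1 (hf w))
      simpa using h2
  rw [eq_top_iff, ← span_range_word, Submodule.span_le]
  rintro _ ⟨w, rfl⟩
  exact key _ w rfl

end Triangular

/-! ### The Lyndon–Shirshov basis over a commutative ring. -/

section PBW

variable {R : Type*} [CommRing R] {X : Type*} [LinearOrder X]

/-- `E` is obtained by iterated bracketing of Lyndon words into Lyndon words. -/
def IsBracketing (E : List X → FreeAlgebra R X) : Prop :=
  (∀ x, E [x] = FreeAlgebra.ι R x) ∧ ∀ w, IsLyndon w → 2 ≤ w.length →
    ∃ u v, IsLyndon u ∧ IsLyndon v ∧ w = u ++ v ∧ E w = ⁅E u, E v⁆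

theorem IsBracketing.induction {E : List X → FreeAlgebra R X} (hE : IsBracketing E)
    {motive : List X → FreeAlgebra R X → Prop}
    (letter : ∀ x, motive [x] (FreeAlgebra.ι R x))
    (lie : ∀ u v a b, IsLyndon (u ++ v) → IsLyndon u → IsLyndon v → motive u a → motive v b →
      motive (u ++ v) ⁅a, b⁆) {w : List X} (hw : IsLyndon w) : motive w (E w) := by
  induction hn : w.length using Nat.strong_induction_on generalizing w with
  | _ n ih =>
    by_cases h2 : 2 ≤ w.length
    · obtain ⟨u, v, hu, hv, rfl, h⟩ := hE.2 w hw h2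
      have hul := List.length_pos_iff.2 hu.1
      have hvl := List.length_pos_iff.2 hv.1
      rw [List.length_append] at hn
      rw [h]
      exact lie u v _ _ hw hu hv (ih u.length (by omega) hu rfl) (ih v.length (by omega) hv rfl)
    · have h0 := List.length_pos_iff.2 hw.1
      obtain ⟨x, rfl⟩ := List.length_eq_one_iff.1 (by omega : w.length = 1)
      rw [hE.1]
      exact letter x

theorem IsBracketing.hasLeadingWord {E : List X → FreeAlgebra R X} (hE : IsBracketing E)
    {w : List X} (hw : IsLyndon w) : HasLeadingWord (E w) w := by
  refine hE.induction (motive := fun w a => HasLeadingWord a w) (fun x => ?_) ?_ hw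
  · rw [← word_singleton]
    exact hasLeadingWord_word _
  · intro u v a b huv hu hv ha hb
    exact ha.lie hb (huv.2 u v hu.1 hv.1 rfl)

/-- The Lyndon–Shirshov basis. -/
def IsBracketing.basis [Finite X] {E : List X → FreeAlgebra R X} (hE : IsBracketing E) :
    Module.Basis (LyndonWord X →₀ ℕ) R (FreeAlgebra R X) :=
  let e := Equiv.ofBijective _ (lyndonProd_bijective (X := X))
  have h : ∀ w, HasLeadingWord (orderedProd (e.symm w) fun α => E α.1) w := fun w => by
    have h := HasLeadingWord.orderedProd (fun α : LyndonWord X => hE.hasLeadingWord α.2) (e.symm w)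
    rwa [show lyndonProd (e.symm w) = w from e.apply_symm_apply w] at h
  (Module.Basis.mk (linearIndependent_of_hasLeadingWord h)
    (span_range_eq_top_of_hasLeadingWord h).ge).reindex e.symm

theorem IsBracketing.basis_apply [Finite X] {E : List X → FreeAlgebra R X} (hE : IsBracketing E)
    (t : LyndonWord X →₀ ℕ) : hE.basis t = orderedProd t fun α => E α.1 := by
  rw [IsBracketing.basis, Module.Basis.reindex_apply, Module.Basis.mk_apply, Equiv.symm_symm,
    Equiv.symm_apply_apply]

end PBW

/-! ### Gradings by length and by number of occurrences of a letter. -/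

section Weights

variable {R : Type*} [CommRing R] {X : Type*}

/-- The projection onto the span of the words of weight `d`. -/
def weightPart (R : Type*) [CommRing R] (ω : List X → ℕ) (d : ℕ) :
    FreeAlgebra R X →ₗ[R] FreeAlgebra R X :=
  (FreeAlgebra.basisFreeMonoid R X).constr R fun w =>
    if ω (FreeMonoid.toList w) = d then word R (FreeMonoid.toList w) else 0

theorem weightPart_word (ω : List X → ℕ) (d : ℕ) (w : List X) :
    weightPart R ω d (word R w) = if ω w = d then word R w else 0 := by
  conv_lhs => rw [word, weightPart, Module.Basis.constr_basis, FreeMonoid.toList_ofList]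

theorem weightPart_of_mem {ω : List X → ℕ} {e : ℕ} (d : ℕ) {a : FreeAlgebra R X}
    (ha : a ∈ wordSpan R {w | ω w = e}) : weightPart R ω d a = if e = d then a else 0 := by
  induction ha using Submodule.span_induction with
  | mem x hx =>
    obtain ⟨w, rfl, rfl⟩ := hx
    exact weightPart_word ω d w
  | zero => simp
  | add x y _ _ hx hy => rw [map_add, hx, hy]; split_ifs <;> simp
  | smul c x _ hx => rw [map_smul, hx]; split_ifs <;> simp

theorem homogeneousPart_eq_weightPart (K : Type*) [Field K] (d : ℕ) (a : FreeAlgebra K (Fin 2)) :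
    homogeneousPart K d a = weightPart K (List.count 1) d a := by
  have h : ∀ w : FreeMonoid (Fin 2),
      homogeneousPart K d (FreeAlgebra.basisFreeMonoid K (Fin 2) w) =
        weightPart K (List.count 1) d (FreeAlgebra.basisFreeMonoid K (Fin 2) w) := fun w => by
    have h1 := weightPart_word (R := K) (List.count (1 : Fin 2)) d (FreeMonoid.toList w)
    rw [word, FreeMonoid.ofList_toList] at h1
    rw [h1, homogeneousPart, Module.Basis.repr_self]
    split_ifs with hd
    · rw [Finsupp.filter_single_of_pos (fun w => (FreeMonoid.toList w).count 1 = d) hd,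
        Module.Basis.repr_symm_single, one_smul]
    · rw [Finsupp.filter_single_of_neg (fun w => (FreeMonoid.toList w).count 1 = d) hd, map_zero]
  have hadd : ∀ x y, homogeneousPart K d (x + y) = homogeneousPart K d x + homogeneousPart K d y :=
    fun x y => by simp [homogeneousPart, Finsupp.filter_add]
  have hsmul : ∀ (c : K) x, homogeneousPart K d (c • x) = c • homogeneousPart K d x :=
    fun c x => by simp [homogeneousPart, Finsupp.filter_smul]
  let φ : FreeAlgebra K (Fin 2) →ₗ[K] FreeAlgebra K (Fin 2) :=
    { toFun := homogeneousPart K d, map_add' := hadd, map_smul' := hsmul }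
  exact LinearMap.congr_fun (show φ = weightPart K (List.count 1) d from
    (FreeAlgebra.basisFreeMonoid K (Fin 2)).ext h) a

/-- A word weight that is additive under concatenation. -/
def IsAdditiveWeight (ω : List X → ℕ) : Prop := ω [] = 0 ∧ ∀ u v, ω (u ++ v) = ω u + ω v

theorem isAdditiveWeight_length : IsAdditiveWeight (List.length (α := X)) :=
  ⟨rfl, fun _ _ => List.length_append⟩

theorem isAdditiveWeight_count [DecidableEq X] (x : X) : IsAdditiveWeight (List.count x) :=
  ⟨rfl, fun _ _ => List.count_append⟩

theorem IsAdditiveWeight.mul_mem {ω : List X → ℕ} (hω : IsAdditiveWeight ω) {d e : ℕ}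
    {a b : FreeAlgebra R X} (ha : a ∈ wordSpan R {w | ω w = d}) (hb : b ∈ wordSpan R {w | ω w = e}) :
    a * b ∈ wordSpan R {w | ω w = d + e} := by
  refine mul_mem_wordSpan ?_ ha hb
  rintro u rfl v rfl
  exact hω.2 u v

theorem IsAdditiveWeight.one_mem {ω : List X → ℕ} (hω : IsAdditiveWeight ω) :
    (1 : FreeAlgebra R X) ∈ wordSpan R {w | ω w = 0} := by
  rw [← word_nil]
  exact word_mem_wordSpan hω.1

theorem IsAdditiveWeight.pow_mem {ω : List X → ℕ} (hω : IsAdditiveWeight ω) {d : ℕ}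
    {a : FreeAlgebra R X} (ha : a ∈ wordSpan R {w | ω w = d}) (m : ℕ) :
    a ^ m ∈ wordSpan R {w | ω w = m * d} := by
  induction m with
  | zero => simpa using hω.one_mem
  | succ m ih =>
    rw [pow_succ, add_mul, one_mul]
    exact hω.mul_mem ih ha

variable [LinearOrder X]

/-- The weight of the product of Lyndon words described by `t`. -/
def weight (ω : List X → ℕ) (t : LyndonWord X →₀ ℕ) : ℕ := t.sum fun α m => m * ω α.1

theorem weight_add (ω : List X → ℕ) (s t : LyndonWord X →₀ ℕ) :
    weight ω (s + t) = weight ω s + weight ω t :=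
  Finsupp.sum_add_index' (by simp) fun _ _ _ => add_mul _ _ _

theorem weight_single (ω : List X → ℕ) (α : LyndonWord X) (m : ℕ) :
    weight ω (Finsupp.single α m) = m * ω α.1 :=
  Finsupp.sum_single_index (zero_mul _)

theorem IsBracketing.mem_wordSpan {E : List X → FreeAlgebra R X} (hE : IsBracketing E)
    {ω : List X → ℕ} (hω : IsAdditiveWeight ω) {w : List X} (hw : IsLyndon w) :
    E w ∈ wordSpan R {v | ω v = ω w} := by
  refine hE.induction (motive := fun w a => a ∈ wordSpan R {v | ω v = ω w}) (fun x => ?_) ?_ hw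
  · rw [← word_singleton]
    exact word_mem_wordSpan rfl
  · intro u v a b _ _ _ ha hb
    rw [Ring.lie_def, hω.2]
    refine sub_mem (hω.mul_mem ha hb) ?_
    rw [add_comm]
    exact hω.mul_mem hb ha

theorem IsBracketing.orderedProd_mem_wordSpan {E : List X → FreeAlgebra R X} (hE : IsBracketing E)
    {ω : List X → ℕ} (hω : IsAdditiveWeight ω) (t : LyndonWord X →₀ ℕ) :
    (orderedProd t fun α => E α.1) ∈ wordSpan R {v | ω v = weight ω t} := by
  induction t using Finsupp.induction_on_max with
  | zero => simpa [weight] using hω.one_mem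
  | single_add β k t hβ hk ih =>
    rw [orderedProd_single_add_of_lt hβ, weight_add, weight_single]
    exact hω.mul_mem (hω.pow_mem (hE.mem_wordSpan hω β.2) k) ih

/-- Each basis element is homogeneous for `ω`, so the projection keeps it or kills it. -/
theorem IsBracketing.repr_weightPart [Finite X] {E : List X → FreeAlgebra R X}
    (hE : IsBracketing E) {ω : List X → ℕ} (hω : IsAdditiveWeight ω) (d : ℕ)
    (a : FreeAlgebra R X) (t : LyndonWord X →₀ ℕ) :
    hE.basis.repr (weightPart R ω d a) t = if weight ω t = d then hE.basis.repr a t else 0 := by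
  classical
  have h : hE.basis.coord t ∘ₗ weightPart R ω d =
      if weight ω t = d then hE.basis.coord t else 0 := by
    refine hE.basis.ext fun s => ?_
    have hs : hE.basis s ∈ wordSpan R {v | ω v = weight ω s} := by
      rw [hE.basis_apply]
      exact hE.orderedProd_mem_wordSpan hω s
    rw [LinearMap.comp_apply, weightPart_of_mem d hs]
    by_cases hst : s = t
    · subst hst
      split_ifs <;> simp
    · have h0 : hE.basis.coord t (hE.basis s) = 0 := by
        rw [Module.Basis.coord_apply, Module.Basis.repr_self, Finsupp.single_eq_of_ne (Ne.symm hst)]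
      split_ifs <;> simp only [h0, map_zero, LinearMap.zero_apply]
  have h1 := LinearMap.congr_fun h a
  split_ifs at h1 ⊢ <;> exact h1

theorem IsBracketing.repr_eq_zero [Finite X] {E : List X → FreeAlgebra R X}
    (hE : IsBracketing E) {ω : List X → ℕ} (hω : IsAdditiveWeight ω) {d : ℕ}
    {a : FreeAlgebra R X} (ha : a ∈ wordSpan R {w | ω w = d}) {t : LyndonWord X →₀ ℕ}
    (ht : weight ω t ≠ d) : hE.basis.repr a t = 0 := by
  have h := hE.repr_weightPart hω d a t
  rwa [weightPart_of_mem d ha, if_pos rfl, if_neg ht] at h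

end Weights

/-! ### The coproduct and the coefficients of powers of a primitive element. -/

section Coproduct

open TensorProduct

variable (R : Type*) [CommRing R] (X : Type*)

/-- The coproduct of the free algebra for which the generators are primitive. -/
def coproduct : FreeAlgebra R X →ₐ[R] FreeAlgebra R X ⊗[R] FreeAlgebra R X :=
  FreeAlgebra.lift R fun x => FreeAlgebra.ι R x ⊗ₜ[R] 1 + 1 ⊗ₜ[R] FreeAlgebra.ι R x

variable {R X}

/-- Primitive elements for `coproduct`. -/
def IsPrimitive (a : FreeAlgebra R X) : Prop := coproduct R X a = a ⊗ₜ[R] 1 + 1 ⊗ₜ[R] a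

theorem isPrimitive_ι (x : X) : IsPrimitive (FreeAlgebra.ι R x) := by
  simp [IsPrimitive, coproduct]

theorem IsPrimitive.add {a b : FreeAlgebra R X} (ha : IsPrimitive a) (hb : IsPrimitive b) :
    IsPrimitive (a + b) := by
  rw [IsPrimitive] at *
  rw [map_add, ha, hb, TensorProduct.add_tmul, TensorProduct.tmul_add]
  abel

theorem IsPrimitive.lie {a b : FreeAlgebra R X} (ha : IsPrimitive a) (hb : IsPrimitive b) :
    IsPrimitive ⁅a, b⁆ := by
  rw [IsPrimitive] at *
  simp only [Ring.lie_def, map_sub, map_mul, ha, hb, mul_add, add_mul,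
    Algebra.TensorProduct.tmul_mul_tmul, one_mul, mul_one, TensorProduct.sub_tmul,
    TensorProduct.tmul_sub]
  abel

theorem IsPrimitive.coproduct_pow {a : FreeAlgebra R X} (ha : IsPrimitive a) (n : ℕ) :
    coproduct R X (a ^ n) =
      ∑ p ∈ Finset.HasAntidiagonal.antidiagonal n, n.choose p.1 • ((a ^ p.1) ⊗ₜ[R] (a ^ p.2)) := by
  have hc : Commute (a ⊗ₜ[R] (1 : FreeAlgebra R X)) ((1 : FreeAlgebra R X) ⊗ₜ[R] a) := by
    simp [Commute, SemiconjBy]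
  rw [map_pow, ha, hc.add_pow']
  refine Finset.sum_congr rfl fun p _ => ?_
  simp [Algebra.TensorProduct.tmul_pow]

variable [LinearOrder X]

theorem IsBracketing.isPrimitive {E : List X → FreeAlgebra R X} (hE : IsBracketing E)
    {w : List X} (hw : IsLyndon w) : IsPrimitive (E w) :=
  hE.induction (motive := fun _ a => IsPrimitive a) isPrimitive_ι
    (fun _ _ _ _ _ _ _ ha hb => ha.lie hb) hw

/-- The product of binomial coefficients `∏ (s(α) + t(α) choose s(α))`. -/
def finsuppChoose {ι : Type*} (s t : ι →₀ ℕ) : ℕ := s.prod fun α m => (m + t α).choose m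

theorem finsuppChoose_single_one {ι : Type*} (α : ι) (t : ι →₀ ℕ) :
    finsuppChoose (Finsupp.single α 1) t = t α + 1 := by
  rw [finsuppChoose, Finsupp.prod_single_index (by simp), Nat.choose_one_right, add_comm]

theorem disjoint_support_single {ι : Type*} {α : ι} {t : ι →₀ ℕ} (h : t α = 0) (m : ℕ) :
    Disjoint (Finsupp.single α m).support t.support := by
  refine Finset.disjoint_left.2 fun β hβ hβs => ?_
  obtain rfl := Finset.mem_singleton.1 (Finsupp.support_single_subset hβ)
  exact Finsupp.mem_support_iff.1 hβs h

theorem finsuppChoose_single_add {ι : Type*} {α : ι} {s t : ι →₀ ℕ} (hs : s α = 0) (ht : t α = 0)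
    (i j : ℕ) : finsuppChoose (Finsupp.single α i + s) (Finsupp.single α j + t) =
      (i + j).choose i * finsuppChoose s t := by
  rw [finsuppChoose, Finsupp.prod_add_index_of_disjoint (disjoint_support_single hs i), Finsupp.prod_single_index (by simp)]
  congr 1
  · simp [ht]
  · refine Finsupp.prod_congr fun β hβ => ?_
    have hne : β ≠ α := by
      rintro rfl
      exact Finsupp.mem_support_iff.1 hβ hs
    simp [Finsupp.single_eq_of_ne hne]

/-- As `α` does not occur in `t`, the exponent of `α` and the rest are split independently. -/
theorem sum_antidiagonal_single_add {ι M : Type*} [DecidableEq ι] [AddCommMonoid M] {α : ι}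
    {t : ι →₀ ℕ} (ht : t α = 0) (m : ℕ) (f : (ι →₀ ℕ) × (ι →₀ ℕ) → M) :
    ∑ p ∈ Finset.HasAntidiagonal.antidiagonal (Finsupp.single α m + t), f p =
      ∑ q ∈ Finset.HasAntidiagonal.antidiagonal m ×ˢ Finset.HasAntidiagonal.antidiagonal t,
        f (Finsupp.single α q.1.1 + q.2.1, Finsupp.single α q.1.2 + q.2.2) := by
  symm
  refine Finset.sum_nbij'
    (fun q => (Finsupp.single α q.1.1 + q.2.1, Finsupp.single α q.1.2 + q.2.2))
    (fun p => ((p.1 α, p.2 α), (p.1.erase α, p.2.erase α))) ?_ ?_ ?_ ?_ ?_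
  · rintro ⟨⟨i, j⟩, ⟨u, v⟩⟩ h
    simp only [Finset.mem_product, Finset.HasAntidiagonal.mem_antidiagonal] at h ⊢
    rw [← h.1, ← h.2, Finsupp.single_add]
    abel
  · rintro ⟨u, v⟩ h
    simp only [Finset.mem_product, Finset.HasAntidiagonal.mem_antidiagonal] at h ⊢
    refine ⟨?_, ?_⟩
    · have := DFunLike.congr_fun h α
      simpa [ht] using this
    · rw [← Finsupp.erase_add, h, Finsupp.erase_add, Finsupp.erase_single, zero_add,
        Finsupp.erase_of_notMem_support (by simpa using ht)]
  · rintro ⟨⟨i, j⟩, ⟨u, v⟩⟩ h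
    simp only [Finset.mem_product, Finset.HasAntidiagonal.mem_antidiagonal] at h
    have h0 := DFunLike.congr_fun h.2 α
    simp only [Finsupp.add_apply, ht, Nat.add_eq_zero_iff] at h0
    simp [h0.1, h0.2, Finsupp.erase_add]
  · rintro ⟨u, v⟩ h
    simp [Finsupp.single_add_erase]
  · intros
    rfl

theorem coproduct_orderedProd {f : LyndonWord X → FreeAlgebra R X} (hf : ∀ α, IsPrimitive (f α))
    (t : LyndonWord X →₀ ℕ) :
    coproduct R X (orderedProd t f) = ∑ p ∈ Finset.HasAntidiagonal.antidiagonal t,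
      finsuppChoose p.1 p.2 • (orderedProd p.1 f ⊗ₜ[R] orderedProd p.2 f) := by
  induction t using Finsupp.induction_on_max with
  | zero => simp [finsuppChoose, Algebra.TensorProduct.one_def]
  | single_add β k t hβ hk ih =>
    have ht : t β = 0 := by
      by_contra h
      exact (hβ β (Finsupp.mem_support_iff.2 h)).false
    rw [orderedProd_single_add_of_lt hβ, map_mul, ih, (hf β).coproduct_pow,
      sum_antidiagonal_single_add ht, Finset.sum_mul_sum, ← Finset.sum_product']
    refine Finset.sum_congr rfl ?_
    rintro ⟨⟨i, j⟩, ⟨u, v⟩⟩ h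
    simp only [Finset.mem_product, Finset.HasAntidiagonal.mem_antidiagonal] at h ⊢
    obtain ⟨rfl, rfl⟩ := h
    simp only [Finsupp.add_apply, Nat.add_eq_zero_iff] at ht
    rw [finsuppChoose_single_add ht.1 ht.2, orderedProd_single_add_of_lt,
      orderedProd_single_add_of_lt, smul_mul_smul_comm, Algebra.TensorProduct.tmul_mul_tmul]
    · intro γ hγ
      refine hβ γ ?_
      simp only [Finsupp.mem_support_iff, Finsupp.add_apply] at hγ ⊢
      omega
    · intro γ hγ
      refine hβ γ ?_
      simp only [Finsupp.mem_support_iff, Finsupp.add_apply] at hγ ⊢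
      omega

/-- Among the basis elements, only `E_{s+t}` has `E_s ⊗ E_t` in its coproduct. -/
theorem IsBracketing.repr_coproduct [Finite X] {E : List X → FreeAlgebra R X}
    (hE : IsBracketing E) (a : FreeAlgebra R X) (s t : LyndonWord X →₀ ℕ) :
    (hE.basis.tensorProduct hE.basis).repr (coproduct R X a) (s, t) =
      finsuppChoose s t * hE.basis.repr a (s + t) := by
  classical
  have h : (hE.basis.tensorProduct hE.basis).coord (s, t) ∘ₗ (coproduct R X).toLinearMap =
      (finsuppChoose s t : R) • hE.basis.coord (s + t) := by
    refine hE.basis.ext fun r => ?_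
    rw [LinearMap.comp_apply, AlgHom.toLinearMap_apply, hE.basis_apply,
      coproduct_orderedProd fun α => hE.isPrimitive α.2, ← hE.basis_apply]
    simp only [← hE.basis_apply, ← Module.Basis.tensorProduct_apply, map_sum, map_nsmul,
      LinearMap.smul_apply, Module.Basis.coord_apply, Module.Basis.repr_self]
    by_cases hr : s + t = r
    · rw [Finset.sum_eq_single (s, t)]
      · simp [hr]
      · intro p _ hp
        rw [Finsupp.single_eq_of_ne (Ne.symm hp), smul_zero]
      · intro h
        exact absurd (Finset.HasAntidiagonal.mem_antidiagonal.2 hr) h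
    · rw [Finsupp.single_eq_of_ne hr, smul_zero]
      refine Finset.sum_eq_zero fun p hp => ?_
      rw [Finsupp.single_eq_of_ne, smul_zero]
      intro h
      rw [Finset.HasAntidiagonal.mem_antidiagonal, ← Prod.ext_iff.1 h |>.1,
        ← Prod.ext_iff.1 h |>.2] at hp
      exact hr hp
  exact LinearMap.congr_fun h a

/-- The product `∏ t(α)! (|α|!)^{t(α)}`. -/
def blockFactorial (t : LyndonWord X →₀ ℕ) : ℕ :=
  t.prod fun α m => m.factorial * α.1.length.factorial ^ m

theorem blockFactorial_single_add {α : LyndonWord X} {t : LyndonWord X →₀ ℕ} (h : t α = 0)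
    (m : ℕ) : blockFactorial (Finsupp.single α m + t) =
      m.factorial * α.1.length.factorial ^ m * blockFactorial t := by
  rw [blockFactorial, Finsupp.prod_add_index_of_disjoint (disjoint_support_single h m),
    Finsupp.prod_single_index (by simp)]
  rfl

theorem prod_pow_single_add {ι M : Type*} [CommMonoid M] (c : ι → M) {α : ι} {t : ι →₀ ℕ}
    (h : t α = 0) (m : ℕ) : ((Finsupp.single α m + t).prod fun β k => c β ^ k) =
      c α ^ m * t.prod fun β k => c β ^ k := by
  rw [Finsupp.prod_add_index_of_disjoint (disjoint_support_single h m),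
    Finsupp.prod_single_index (by simp)]

/-- The coefficient of a basis monomial in the power of `a` of the same length. -/
def powCoeff {E : List X → FreeAlgebra R X} [Finite X] (hE : IsBracketing E)
    (a : FreeAlgebra R X) (t : LyndonWord X →₀ ℕ) : R :=
  hE.basis.repr (a ^ weight List.length t) t

/-- Both sides are the coefficient of `E_s ⊗ E_t` in the coproduct of a power of `a`: one through
the PBW expansion, the other through the binomial formula, where the grading by length leaves a
single term. -/
theorem finsuppChoose_mul_powCoeff [Finite X] {E : List X → FreeAlgebra R X}
    (hE : IsBracketing E) {a : FreeAlgebra R X} (ha : IsPrimitive a)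
    (ha1 : a ∈ wordSpan R {w | w.length = 1}) (s t : LyndonWord X →₀ ℕ) :
    finsuppChoose s t * powCoeff hE a (s + t) =
      (weight List.length s + weight List.length t).choose (weight List.length s) *
        (powCoeff hE a s * powCoeff hE a t) := by
  have hpow : ∀ m, a ^ m ∈ wordSpan R {w | w.length = m} := fun m => by
    simpa using isAdditiveWeight_length.pow_mem ha1 m
  rw [powCoeff, ← hE.repr_coproduct, weight_add, ha.coproduct_pow]
  simp only [map_sum, map_nsmul, Finsupp.finsetSum_apply, Finsupp.smul_apply,
    Module.Basis.tensorProduct_repr_tmul_apply]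
  rw [Finset.sum_eq_single (weight List.length s, weight List.length t)]
  · simp only [smul_eq_mul, nsmul_eq_mul, powCoeff]
    ring
  · rintro ⟨i, j⟩ hij hne
    rw [Finset.HasAntidiagonal.mem_antidiagonal] at hij
    have hi : weight List.length s ≠ i := by
      rintro rfl
      exact hne (Prod.ext rfl (by simpa using hij))
    simp [hE.repr_eq_zero isAdditiveWeight_length (hpow i) hi]
  · intro h
    exact absurd (Finset.HasAntidiagonal.mem_antidiagonal.2 (by rfl)) h

/-- One copy of a Lyndon word is split off at a time with `finsuppChoose_mul_powCoeff`. Keeping the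
factorials on the left avoids division. -/
theorem powCoeff_mul_blockFactorial [Finite X] {E : List X → FreeAlgebra R X}
    (hE : IsBracketing E) {a : FreeAlgebra R X} (ha : IsPrimitive a)
    (ha1 : a ∈ wordSpan R {w | w.length = 1}) (t : LyndonWord X →₀ ℕ) :
    powCoeff hE a t * blockFactorial t = (weight List.length t).factorial *
      t.prod fun α m => powCoeff hE a (Finsupp.single α 1) ^ m := by
  induction t using Finsupp.induction with
  | zero =>
    have h : hE.basis 0 = 1 := by rw [hE.basis_apply, orderedProd_zero]
    simp [powCoeff, weight, blockFactorial, ← h]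
  | single_add α m t hα hm ih =>
    have ht : t α = 0 := Finsupp.notMem_support_iff.1 hα
    -- The inner induction on the multiplicity starts at `0`, where the claim is `ih`.
    clear hm
    induction m with
    | zero => simpa using ih
    | succ m ihm =>
      have h := finsuppChoose_mul_powCoeff hE ha ha1 (Finsupp.single α 1) (Finsupp.single α m + t)
      have hsingle : Finsupp.single α (m + 1) + t =
          Finsupp.single α 1 + (Finsupp.single α m + t) := by
        rw [← add_assoc, ← Finsupp.single_add, add_comm 1 m]
      rw [blockFactorial_single_add ht, prod_pow_single_add _ ht] at ihm ⊢
      rw [finsuppChoose_single_one, ← hsingle] at h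
      have hw : weight List.length (Finsupp.single α (m + 1) + t) =
          weight List.length (Finsupp.single α 1) + weight List.length (Finsupp.single α m + t) := by
        rw [hsingle, weight_add]
      rw [hw]
      set p := weight List.length (Finsupp.single α 1)
      set q := weight List.length (Finsupp.single α m + t)
      have hp : α.1.length = p := by simp [p, weight_single]
      have hc := congrArg (Nat.cast (R := R)) (Nat.add_choose_mul_factorial_mul_factorial q p)
      rw [add_comm q p] at hc
      rw [hp] at ihm ⊢
      simp only [Finsupp.add_apply, Finsupp.single_eq_same, ht] at h
      push_cast [Nat.factorial_succ] at h hc ihm ⊢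
      linear_combination (m.factorial * p.factorial ^ (m + 1) * blockFactorial t : R) * h +
        ((p + q).choose p * p.factorial * powCoeff hE a (Finsupp.single α 1) : R) * ihm +
        (powCoeff hE a (Finsupp.single α 1) ^ (m + 1) *
          (t.prod fun β k => powCoeff hE a (Finsupp.single β 1) ^ k)) * hc

end Coproduct

/-! ### Bell polynomials and the binomial theorem for commuting operators. -/

section BellPolynomials

variable {A : Type*} [Ring A]

/-- The binomial formula that defines the Bell polynomials without differentiation. -/
theorem sum_choose_bell_mul_pow (x y : A) (n : ℕ) :
    ∑ m ∈ Finset.range (n + 1), n.choose m • (bell x y m * x ^ (n - m)) = (x + y) ^ n := by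
  -- With `d` defined as the difference, `d + r` is left multiplication by `x + y`. Left and right
  -- multiplications commute by associativity, so `d` and `r` commute.
  let r : Module.End ℤ A := LinearMap.mulRight ℤ x
  let d : Module.End ℤ A := LinearMap.mulLeft ℤ (x + y) - r
  have hd : ∀ a, d a = ⁅x, a⁆ + y * a := fun a => by
    simp only [d, r, LinearMap.sub_apply, LinearMap.mulLeft_apply, LinearMap.mulRight_apply,
      Ring.lie_def]
    noncomm_ring
  have hbell : ∀ m, (d ^ m) 1 = bell x y m := fun m => by
    induction m with
    | zero => rfl
    | succ m ih => rw [pow_succ', Module.End.mul_apply, ih, hd, bell]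
  have hr : ∀ (m : ℕ) a, (r ^ m) a = a * x ^ m := fun m => by
    induction m with
    | zero => simp
    | succ m ih =>
      intro a
      rw [pow_succ, Module.End.mul_apply, ih, LinearMap.mulRight_apply, mul_assoc, ← pow_succ']
  have hl : ∀ m : ℕ, (LinearMap.mulLeft ℤ (x + y) ^ m : Module.End ℤ A) 1 = (x + y) ^ m :=
    fun m => by simp [LinearMap.pow_mulLeft]
  have hc : Commute d r := by
    refine Commute.sub_left ?_ (Commute.refl r)
    exact LinearMap.ext fun a => (mul_assoc (x + y) a x).symm
  have h := hc.add_pow n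
  rw [sub_add_cancel] at h
  have h1 := LinearMap.congr_fun h 1
  rw [hl] at h1
  rw [h1, LinearMap.sum_apply]
  refine Finset.sum_congr rfl fun m _ => ?_
  rw [(hc.pow_pow m (n - m)).eq, ← Nat.cast_comm, ← nsmul_eq_mul, LinearMap.smul_apply,
    Module.End.mul_apply, hbell, hr]

/-- The system is unitriangular: the last term of the `n`-th equation is `f n` itself. -/
theorem eq_of_sum_choose_mul_pow_eq (x : A) {f g : ℕ → A}
    (h : ∀ n, ∑ m ∈ Finset.range (n + 1), n.choose m • (f m * x ^ (n - m)) =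
      ∑ m ∈ Finset.range (n + 1), n.choose m • (g m * x ^ (n - m))) (n : ℕ) : f n = g n := by
  induction n using Nat.strong_induction_on with
  | _ n ih =>
    have hn := h n
    rw [Finset.sum_range_succ, Finset.sum_range_succ, Finset.sum_congr rfl fun m hm => by
      rw [ih m (Finset.mem_range.1 hm)]] at hn
    simpa using hn

end BellPolynomials

/-! ### Bracketings over the integers and their images over a field. -/

section BaseChange

variable {X : Type*} [LinearOrder X]

open Classical in
/-- The bracketing of words over the integers. -/
def intBracket (w : List X) : FreeAlgebra ℤ X :=
  match w with
  | [] => 0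
  | [x] => FreeAlgebra.ι ℤ x
  | x :: y :: l =>
    if h : ∃ p : List X × List X, IsStandardFactorization (x :: y :: l) p then
      ⁅intBracket h.choose.1, intBracket h.choose.2⁆
    else 0
termination_by w.length
decreasing_by
  all_goals
    have hp := h.choose_spec
    have hl := congrArg List.length hp.1
    have h1 := List.length_pos_iff.mpr hp.2.1.1
    have h2 := List.length_pos_iff.mpr hp.2.2.1.1
    simp only [List.length_append, List.length_cons] at hl ⊢
    omega

theorem isBracketing_intBracket : IsBracketing (intBracket (X := X)) := by
  refine ⟨fun x => by rw [intBracket], fun w hw h2 => ?_⟩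
  match w with
  | x :: y :: l =>
    have h := hw.exists_isStandardFactorization h2
    have hp := h.choose_spec
    refine ⟨_, _, hp.2.1, hp.2.2.1, hp.1, ?_⟩
    rw [intBracket, dif_pos h]

/-- The base change map from integral coefficients to `K`. -/
def baseChange (K : Type*) [Field K] (X : Type*) : FreeAlgebra ℤ X →ₐ[ℤ] FreeAlgebra K X :=
  FreeAlgebra.lift ℤ (FreeAlgebra.ι K)

variable (K : Type*) [Field K]

theorem baseChange_ι {X : Type*} (x : X) :
    baseChange K X (FreeAlgebra.ι ℤ x) = FreeAlgebra.ι K x := by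
  simp [baseChange]

/-- The chosen standard factorization does not depend on the coefficients, so both recursions split
the word at the same place. -/
theorem baseChange_intBracket (w : List X) :
    baseChange K X (intBracket w) = lyndonBracket K w := by
  induction hn : w.length using Nat.strong_induction_on generalizing w with
  | _ n ih =>
    match w with
    | [] => rw [intBracket, lyndonBracket, map_zero]
    | [x] => rw [intBracket, lyndonBracket, baseChange_ι]
    | x :: y :: l =>
      rw [intBracket, lyndonBracket]
      split_ifs with h
      · have hp := h.choose_spec
        have hl := congrArg List.length hp.1
        have h1 := List.length_pos_iff.mpr hp.2.1.1
        have h2 := List.length_pos_iff.mpr hp.2.2.1.1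
        rw [List.length_append, hn] at hl
        rw [Ring.lie_def, Ring.lie_def, map_sub, map_mul, map_mul, ih _ (by omega) _ rfl,
          ih _ (by omega) _ rfl]
      · rw [map_zero]

theorem isBracketing_lyndonBracket : IsBracketing (lyndonBracket K (X := X)) := by
  refine ⟨fun x => by rw [lyndonBracket], fun w hw h2 => ?_⟩
  obtain ⟨u, v, hu, hv, huv, h⟩ := isBracketing_intBracket.2 w hw h2
  refine ⟨u, v, hu, hv, huv, ?_⟩
  simp only [← baseChange_intBracket, h, Ring.lie_def, map_sub, map_mul]

/-- The Lyndon–Shirshov basis over `K`. -/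
abbrev pbwBasis (X : Type*) [LinearOrder X] [Finite X] :
    Module.Basis (LyndonWord X →₀ ℕ) K (FreeAlgebra K X) :=
  (isBracketing_lyndonBracket K (X := X)).basis

theorem pbwBasis_apply [Finite X] (t : LyndonWord X →₀ ℕ) :
    pbwBasis K X t = pbwMonomial K t :=
  (isBracketing_lyndonBracket K).basis_apply t

theorem repr_baseChange [Finite X] (a : FreeAlgebra ℤ X) (t : LyndonWord X →₀ ℕ) :
    (pbwBasis K X).repr (baseChange K X a) t =
      (isBracketing_intBracket.basis.repr a t : ℤ) := by
  classical
  have h : ((pbwBasis K X).coord t).toAddMonoidHom.toIntLinearMap ∘ₗ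
      (baseChange K X).toLinearMap =
      (Int.castAddHom K).toIntLinearMap ∘ₗ isBracketing_intBracket.basis.coord t := by
    refine isBracketing_intBracket.basis.ext fun s => ?_
    have hs : baseChange K X (isBracketing_intBracket.basis s) = pbwBasis K X s := by
      rw [isBracketing_intBracket.basis_apply, map_orderedProd, pbwBasis_apply, pbwMonomial]
      simp only [baseChange_intBracket]
    change (pbwBasis K X).repr (baseChange K X (isBracketing_intBracket.basis s)) t =
      ((isBracketing_intBracket.basis.repr (isBracketing_intBracket.basis s) t : ℤ) : K)
    rw [hs, Module.Basis.repr_self, Module.Basis.repr_self, Finsupp.single_apply,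
      Finsupp.single_apply]
    split_ifs <;> simp
  exact LinearMap.congr_fun h a

end BaseChange

/-! ### Integrality of the factorial quotients and the coefficients over a field. -/

section PowerExpansion

variable {X : Type*} [LinearOrder X]

theorem blockFactorial_pos (t : LyndonWord X →₀ ℕ) : 0 < blockFactorial t :=
  Finset.prod_pos fun _ _ => Nat.mul_pos (Nat.factorial_pos _) (pow_pos (Nat.factorial_pos _) _)

/-- The quotient counts the partitions of a set of `m * k` elements into `m` blocks of size `k`. -/
theorem factorial_mul_factorial_pow_dvd (m : ℕ) {k : ℕ} (hk : k ≠ 0) :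
    m.factorial * k.factorial ^ m ∣ (m * k).factorial := by
  refine ⟨Nat.uniformBell m k, ?_⟩
  rw [← Nat.uniformBell_mul_eq m hk]
  ring

theorem blockFactorial_dvd (t : LyndonWord X →₀ ℕ) :
    blockFactorial t ∣ (weight List.length t).factorial := by
  refine dvd_trans (Finset.prod_dvd_prod_of_dvd _ (fun α => (t α * α.1.length).factorial)
    fun α _ => ?_) (Nat.prod_factorial_dvd_factorial_sum _ _)
  exact factorial_mul_factorial_pow_dvd _ (List.length_pos_iff.2 α.2.1).ne'

variable [Finite X] (K : Type*) [Field K]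

theorem powCoeff_baseChange (a : FreeAlgebra ℤ X) (t : LyndonWord X →₀ ℕ) :
    powCoeff (isBracketing_lyndonBracket K) (baseChange K X a) t =
      (powCoeff isBracketing_intBracket a t : ℤ) := by
  rw [powCoeff, powCoeff, ← map_pow]
  exact repr_baseChange K _ t

/-- `blockFactorial t` may vanish in `K`, so it is cancelled in `ℤ` before the coefficients are
mapped to `K`. -/
theorem powCoeff_eq {a : FreeAlgebra ℤ X} (ha : IsPrimitive a)
    (ha1 : a ∈ wordSpan ℤ {w | w.length = 1}) (t : LyndonWord X →₀ ℕ) :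
    powCoeff (isBracketing_lyndonBracket K) (baseChange K X a) t =
      (((weight List.length t).factorial / blockFactorial t : ℕ) : K) *
        t.prod fun α m => powCoeff (isBracketing_lyndonBracket K) (baseChange K X a)
          (Finsupp.single α 1) ^ m := by
  have h := powCoeff_mul_blockFactorial isBracketing_intBracket ha ha1 t
  obtain ⟨c, hc⟩ := blockFactorial_dvd t
  have hpos := blockFactorial_pos t
  have hc' : (weight List.length t).factorial / blockFactorial t = c := by
    rw [hc, Nat.mul_div_cancel_left _ hpos]
  have hZ : powCoeff isBracketing_intBracket a t =
      c * t.prod fun α m => powCoeff isBracketing_intBracket a (Finsupp.single α 1) ^ m := by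
    have hne : (blockFactorial t : ℤ) ≠ 0 := by exact_mod_cast hpos.ne'
    refine mul_right_cancel₀ hne ?_
    rw [h, hc]
    push_cast
    ring
  simp only [powCoeff_baseChange, hZ, hc', Finsupp.prod]
  push_cast
  rfl

end PowerExpansion

/-! ### Two letters: from the powers of `E₁ + E₂` to the Bell polynomials. -/

section TwoLetters

/-- The letter `1` as a Lyndon word. -/
def letter₁ : LyndonWord (Fin 2) := ⟨[0], isLyndon_singleton 0⟩

/-- The letter `2` as a Lyndon word. -/
def letter₂ : LyndonWord (Fin 2) := ⟨[1], isLyndon_singleton 1⟩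

theorem letter₁_lt_letter₂ : letter₁ < letter₂ :=
  List.cons_lt_cons_iff.2 (Or.inl (by decide : (0 : Fin 2) < 1))

theorem letter₁_le (α : LyndonWord (Fin 2)) : letter₁ ≤ α := by
  obtain ⟨w, hw⟩ := α
  match w with
  | [] => exact absurd rfl hw.1
  | x :: l =>
    rcases (Fin.zero_le x).eq_or_lt with rfl | hx
    · exact le_append [0] l
    · exact (List.cons_lt_cons_iff.2 (Or.inl hx) : [0] < x :: l).le

/-- A Lyndon word is at most its last letter, which is a suffix. -/
theorem le_letter₂ (α : LyndonWord (Fin 2)) : α ≤ letter₂ := by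
  obtain ⟨w, hw⟩ := α
  have hlast : ∀ x : Fin 2, [x] ≤ [1] := fun x => by
    rcases (Fin.le_last x).eq_or_lt with rfl | hx
    · exact le_rfl
    · exact (List.cons_lt_cons_iff.2 (Or.inl hx) : [x] < [Fin.last 1]).le
  obtain ⟨u, x, rfl⟩ : ∃ u x, w = u ++ [x] :=
    ⟨w.dropLast, w.getLast hw.1, (List.dropLast_append_getLast hw.1).symm⟩
  change u ++ [x] ≤ [1]
  refine le_trans ?_ (hlast x)
  rcases eq_or_ne u [] with rfl | hu
  · exact le_rfl
  · exact (hw.lt_suffix hu (by simp) rfl).le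

theorem isMiddle_iff (t : LyndonWord (Fin 2) →₀ ℕ) :
    IsMiddle t ↔ t letter₁ = 0 ∧ t letter₂ = 0 := by
  constructor
  · intro h
    constructor <;> by_contra h0
    · exact lt_irrefl _ (h _ (Finsupp.mem_support_iff.2 h0)).1
    · exact lt_irrefl _ (h _ (Finsupp.mem_support_iff.2 h0)).2
  · rintro ⟨h1, h2⟩ α hα
    have hα0 := Finsupp.mem_support_iff.1 hα
    exact ⟨lt_of_le_of_ne (letter₁_le α) fun h => hα0 ((Subtype.ext h : letter₁ = α) ▸ h1),
      lt_of_le_of_ne (le_letter₂ α) fun h => hα0 ((Subtype.ext h : α = letter₂) ▸ h2)⟩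

theorem mem_indexSet {n : ℕ} {p : ℕ × (LyndonWord (Fin 2) →₀ ℕ)} :
    p ∈ indexSet n ↔ IsMiddle p.2 ∧ p.1 + weight List.length p.2 = n :=
  (finite_index n).mem_toFinset

/-- Add the exponents of the letters to the exponents of the other Lyndon words. -/
def extend (p : ℕ × (LyndonWord (Fin 2) →₀ ℕ)) (m : ℕ) : LyndonWord (Fin 2) →₀ ℕ :=
  Finsupp.single letter₂ p.1 + (p.2 + Finsupp.single letter₁ m)

section Extend

variable {p : ℕ × (LyndonWord (Fin 2) →₀ ℕ)}

theorem weight_extend (m : ℕ) :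
    weight List.length (extend p m) = p.1 + weight List.length p.2 + m := by
  rw [extend, weight_add, weight_add, weight_single, weight_single]
  simp [letter₁, letter₂, add_assoc]

theorem add_single_letter₁_letter₂ (hp : IsMiddle p.2) (m : ℕ) :
    (p.2 + Finsupp.single letter₁ m) letter₂ = 0 := by
  rw [Finsupp.add_apply, ((isMiddle_iff _).1 hp).2, zero_add,
    Finsupp.single_eq_of_ne letter₁_lt_letter₂.ne']

theorem extend_letter₂ (hp : IsMiddle p.2) (m : ℕ) : extend p m letter₂ = p.1 := by
  rw [extend, Finsupp.add_apply, add_single_letter₁_letter₂ hp, Finsupp.single_eq_same, add_zero]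

theorem extend_erase (hp : IsMiddle p.2) (m : ℕ) :
    ((extend p m).erase letter₂).erase letter₁ = p.2 := by
  obtain ⟨h1, h2⟩ := (isMiddle_iff _).1 hp
  ext α
  rcases eq_or_ne α letter₁ with rfl | hα1
  · simp [h1]
  rcases eq_or_ne α letter₂ with rfl | hα2
  · simp [Finsupp.erase_ne hα1, h2]
  · simp [extend, Finsupp.erase_ne hα1, Finsupp.erase_ne hα2, Finsupp.single_eq_of_ne hα1]

theorem blockFactorial_extend (hp : IsMiddle p.2) (m : ℕ) :
    blockFactorial (extend p m) = denom p * m.factorial := by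
  rw [extend, blockFactorial_single_add (add_single_letter₁_letter₂ hp m), add_comm p.2,
    blockFactorial_single_add ((isMiddle_iff _).1 hp).1, denom]
  simp only [letter₁, letter₂, List.length_singleton, Nat.factorial_one, one_pow, mul_one,
    blockFactorial]
  ring

theorem prod_pow_extend {M : Type*} [CommMonoid M] {c : LyndonWord (Fin 2) → M}
    (h1 : c letter₁ = 1) (h2 : c letter₂ = 1) (hp : IsMiddle p.2) (m : ℕ) :
    ((extend p m).prod fun α k => c α ^ k) = p.2.prod fun α k => c α ^ k := by
  rw [extend, prod_pow_single_add _ (add_single_letter₁_letter₂ hp m), add_comm p.2,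
    prod_pow_single_add _ ((isMiddle_iff _).1 hp).1, h1, h2]
  simp

theorem orderedProd_extend {A : Type*} [Monoid A] (hp : IsMiddle p.2) (m : ℕ)
    (f : LyndonWord (Fin 2) → A) :
    orderedProd (extend p m) f = f letter₂ ^ p.1 * orderedProd p.2 f * f letter₁ ^ m := by
  rw [extend, orderedProd_single_add_of_le fun α _ => le_letter₂ α,
    orderedProd_add_single_of_lt fun α hα => (hp α hα).1, mul_assoc]

end Extend

theorem exists_extend_eq {n : ℕ} {t : LyndonWord (Fin 2) →₀ ℕ} (ht : weight List.length t = n) :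
    ∃ m ∈ Finset.range (n + 1), ∃ p ∈ indexSet m, extend p (n - m) = t := by
  let p : ℕ × (LyndonWord (Fin 2) →₀ ℕ) := (t letter₂, (t.erase letter₂).erase letter₁)
  have hp : IsMiddle p.2 := by
    rw [isMiddle_iff]
    simp [p, Finsupp.erase_ne letter₁_lt_letter₂.ne']
  have he : extend p (t letter₁) = t := by
    have h := Finsupp.erase_add_single letter₁ (t.erase letter₂)
    rw [Finsupp.erase_ne letter₁_lt_letter₂.ne] at h
    rw [extend, h, Finsupp.single_add_erase]
  have hw := weight_extend (p := p) (t letter₁)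
  rw [he, ht] at hw
  refine ⟨p.1 + weight List.length p.2, Finset.mem_range.2 (by omega), p,
    mem_indexSet.2 ⟨hp, rfl⟩, ?_⟩
  rw [hw, Nat.add_sub_cancel_left, he]

theorem denom_dvd_factorial {n : ℕ} {p : ℕ × (LyndonWord (Fin 2) →₀ ℕ)} (hp : p ∈ indexSet n) :
    denom p ∣ n.factorial := by
  obtain ⟨-, rfl⟩ := mem_indexSet.1 hp
  exact (mul_dvd_mul_left _ (blockFactorial_dvd p.2)).trans
    (Nat.factorial_mul_factorial_dvd_factorial_add _ _)

theorem denom_pos (p : ℕ × (LyndonWord (Fin 2) →₀ ℕ)) : 0 < denom p :=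
  Nat.mul_pos (Nat.factorial_pos _) (blockFactorial_pos p.2)

theorem factorial_div_blockFactorial_extend {n m : ℕ} (hm : m ≤ n)
    {p : ℕ × (LyndonWord (Fin 2) →₀ ℕ)} (hp : p ∈ indexSet m) :
    n.factorial / blockFactorial (extend p (n - m)) =
      n.choose m * (m.factorial / denom p) := by
  obtain ⟨c, hc⟩ := denom_dvd_factorial hp
  rw [blockFactorial_extend (mem_indexSet.1 hp).1, hc, Nat.mul_div_cancel_left _ (denom_pos p),
    ← Nat.choose_mul_factorial_mul_factorial hm, hc]
  refine Nat.div_eq_of_eq_mul_left (Nat.mul_pos (denom_pos p) (Nat.factorial_pos _)) ?_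
  ring

theorem length_eq_count_add_count (l : List (Fin 2)) : l.length = l.count 1 + l.count 0 := by
  induction l with
  | nil => rfl
  | cons a l ih => fin_cases a <;> simp [ih] <;> omega

theorem weight_length_eq (t : LyndonWord (Fin 2) →₀ ℕ) :
    weight List.length t = weight (List.count 1) t + weight (List.count 0) t := by
  simp only [weight, Finsupp.sum, ← Finset.sum_add_distrib, length_eq_count_add_count, mul_add]

variable (K : Type*) [Field K]

/-- The sum `E₁ + E₂` with integral coefficients. -/
def intGenSum : FreeAlgebra ℤ (Fin 2) := FreeAlgebra.ι ℤ 0 + FreeAlgebra.ι ℤ 1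

theorem baseChange_intGenSum : baseChange K (Fin 2) intGenSum = gen₁ K + gen₂ K := by
  rw [intGenSum, map_add, baseChange_ι, baseChange_ι]
  rfl

theorem isPrimitive_intGenSum : IsPrimitive intGenSum :=
  (isPrimitive_ι 0).add (isPrimitive_ι 1)

theorem genSum_mem_wordSpan (R : Type*) [CommRing R] :
    FreeAlgebra.ι R (0 : Fin 2) + FreeAlgebra.ι R 1 ∈ wordSpan R {w : List (Fin 2) | w.length = 1} := by
  rw [← word_singleton, ← word_singleton]
  exact add_mem (word_mem_wordSpan rfl) (word_mem_wordSpan rfl)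

/-- The coefficient of `E_t` in the power of `E₁ + E₂` of the same length. -/
abbrev genCoeff (t : LyndonWord (Fin 2) →₀ ℕ) : K :=
  powCoeff (isBracketing_lyndonBracket K) (gen₁ K + gen₂ K) t

/-- `E_α` is homogeneous of degree `α(2)` in `E₂`, so passing from `(E₁ + E₂) ^ |α|` to its part of
that degree does not change the coefficient. -/
theorem coeffC_eq_genCoeff (α : LyndonWord (Fin 2)) :
    coeffC (pbwBasis K (Fin 2)) α = genCoeff K (Finsupp.single α 1) := by
  rw [coeffC, shuffleType, homogeneousPart_eq_weightPart,
    IsBracketing.repr_weightPart _ (isAdditiveWeight_count 1), weight_single, one_mul, if_pos rfl,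
    ← length_eq_count_add_count, genCoeff, powCoeff, weight_single, one_mul]

theorem pbwBasis_single_letter₁ : pbwBasis K (Fin 2) (Finsupp.single letter₁ 1) = gen₁ K := by
  rw [pbwBasis_apply, pbwMonomial, orderedProd_single, pow_one]
  exact (isBracketing_lyndonBracket K).1 0

theorem pbwBasis_single_letter₂ : pbwBasis K (Fin 2) (Finsupp.single letter₂ 1) = gen₂ K := by
  rw [pbwBasis_apply, pbwMonomial, orderedProd_single, pow_one]
  exact (isBracketing_lyndonBracket K).1 1

theorem genCoeff_letter₁ : genCoeff K (Finsupp.single letter₁ 1) = 1 := by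
  have hne : Finsupp.single letter₁ 1 ≠ Finsupp.single letter₂ 1 := fun h =>
    letter₁_lt_letter₂.ne ((Finsupp.single_left_inj one_ne_zero).1 h)
  rw [genCoeff, powCoeff, weight_single]
  simp only [letter₁, List.length_singleton, mul_one, pow_one, map_add, Finsupp.add_apply]
  rw [← pbwBasis_single_letter₁, ← pbwBasis_single_letter₂, Module.Basis.repr_self,
    Module.Basis.repr_self]
  erw [Finsupp.single_eq_same, Finsupp.single_eq_of_ne hne, add_zero]

theorem genCoeff_letter₂ : genCoeff K (Finsupp.single letter₂ 1) = 1 := by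
  have hne : Finsupp.single letter₂ 1 ≠ Finsupp.single letter₁ 1 := fun h =>
    letter₁_lt_letter₂.ne' ((Finsupp.single_left_inj one_ne_zero).1 h)
  rw [genCoeff, powCoeff, weight_single]
  simp only [letter₂, List.length_singleton, mul_one, pow_one, map_add, Finsupp.add_apply]
  rw [← pbwBasis_single_letter₁, ← pbwBasis_single_letter₂, Module.Basis.repr_self,
    Module.Basis.repr_self]
  erw [Finsupp.single_eq_same, Finsupp.single_eq_of_ne hne, zero_add]

theorem integralTerm_eq (n : ℕ) (p : ℕ × (LyndonWord (Fin 2) →₀ ℕ)) :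
    integralTerm (pbwBasis K (Fin 2)) n p =
      (((n.factorial / denom p : ℕ) : K) *
        p.2.prod fun α m => genCoeff K (Finsupp.single α 1) ^ m) •
      (gen₂ K ^ p.1 * orderedProd p.2 fun α => lyndonBracket K α.1) := by
  rw [integralTerm, orderedProd_smul, mul_smul_comm, smul_smul]
  simp only [coeffC_eq_genCoeff]

/-- Splitting off the final power of `E₁` turns `n! / (denom p * (n - m)!)` into `(n choose m) * (m!
/ denom p)`; the letters have coefficient `1` and contribute nothing else. -/
theorem genCoeff_smul_extend {n m : ℕ} (hm : m ≤ n) {p : ℕ × (LyndonWord (Fin 2) →₀ ℕ)}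
    (hp : p ∈ indexSet m) :
    genCoeff K (extend p (n - m)) • pbwBasis K (Fin 2) (extend p (n - m)) =
      n.choose m • (integralTerm (pbwBasis K (Fin 2)) m p * gen₁ K ^ (n - m)) := by
  obtain ⟨hmid, hw⟩ := mem_indexSet.1 hp
  have hweight : weight List.length (extend p (n - m)) = n := by
    rw [weight_extend, hw]
    omega
  have h := powCoeff_eq K isPrimitive_intGenSum (genSum_mem_wordSpan ℤ) (extend p (n - m))
  rw [baseChange_intGenSum, hweight, factorial_div_blockFactorial_extend hm hp,
    prod_pow_extend (genCoeff_letter₁ K) (genCoeff_letter₂ K) hmid] at h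
  rw [genCoeff, h, pbwBasis_apply, pbwMonomial, orderedProd_extend hmid, integralTerm_eq,
    smul_mul_assoc, ← Nat.cast_smul_eq_nsmul K, smul_smul]
  have h1 : lyndonBracket K letter₁.1 = gen₁ K := (isBracketing_lyndonBracket K).1 0
  have h2 : lyndonBracket K letter₂.1 = gen₂ K := (isBracketing_lyndonBracket K).1 1
  rw [h1, h2]
  push_cast
  rw [mul_assoc]

theorem sum_choose_integralTerm (n : ℕ) :
    ∑ m ∈ Finset.range (n + 1), n.choose m •
        ((∑ p ∈ indexSet m, integralTerm (pbwBasis K (Fin 2)) m p) * gen₁ K ^ (n - m)) =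
      (gen₁ K + gen₂ K) ^ n := by
  classical
  have hpow : (gen₁ K + gen₂ K) ^ n ∈ wordSpan K {w | w.length = n} := by
    simpa [gen₁, gen₂] using isAdditiveWeight_length.pow_mem (genSum_mem_wordSpan K) n
  let S : Finset ((_ : ℕ) × (ℕ × (LyndonWord (Fin 2) →₀ ℕ))) :=
    (Finset.range (n + 1)).sigma fun m => indexSet m
  -- The exponents other than that of `1` recover `p`, and `m` is the total length of `p`.
  have hinj : Set.InjOn (fun q : (_ : ℕ) × (ℕ × (LyndonWord (Fin 2) →₀ ℕ)) =>
      extend q.2 (n - q.1)) S := by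
    rintro ⟨m, p⟩ hp ⟨m', p'⟩ hp' h
    have hp := mem_indexSet.1 (Finset.mem_sigma.1 hp).2
    have hp' := mem_indexSet.1 (Finset.mem_sigma.1 hp').2
    dsimp only at h hp hp'
    have h1 : p = p' := by
      refine Prod.ext ?_ ?_
      · rw [← extend_letter₂ hp.1 (n - m), h, extend_letter₂ hp'.1]
      · rw [← extend_erase hp.1 (n - m), h, extend_erase hp'.1]
    subst h1
    obtain rfl : m = m' := hp.2.symm.trans hp'.2
    rfl
  have hsub : ((pbwBasis K (Fin 2)).repr ((gen₁ K + gen₂ K) ^ n)).support ⊆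
      S.image fun q => extend q.2 (n - q.1) := by
    intro t ht
    have hw : weight List.length t = n := by
      by_contra hne
      exact Finsupp.mem_support_iff.1 ht
        (IsBracketing.repr_eq_zero _ isAdditiveWeight_length hpow hne)
    obtain ⟨m, hm, p, hp, h⟩ := exists_extend_eq hw
    exact Finset.mem_image.2 ⟨⟨m, p⟩, Finset.mem_sigma.2 ⟨hm, hp⟩, h⟩
  conv_rhs => rw [← (pbwBasis K (Fin 2)).linearCombination_repr ((gen₁ K + gen₂ K) ^ n),
    Finsupp.linearCombination_apply, Finsupp.sum_of_support_subset _ hsub _ (by simp),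
    Finset.sum_image hinj, Finset.sum_sigma]
  refine Finset.sum_congr rfl fun m hm => ?_
  rw [Finset.sum_mul, Finset.smul_sum]
  refine Finset.sum_congr rfl fun p hp => ?_
  have hmn : m ≤ n := Nat.lt_succ_iff.1 (Finset.mem_range.1 hm)
  have hweight : weight List.length (extend p (n - m)) = n := by
    rw [weight_extend, (mem_indexSet.1 hp).2]
    omega
  have h := genCoeff_smul_extend K hmn hp
  rw [genCoeff, powCoeff, hweight] at h
  exact h.symm

theorem bell_eq_sum_integralTerm (n : ℕ) :
    bell (gen₁ K) (gen₂ K) n = ∑ p ∈ indexSet n, integralTerm (pbwBasis K (Fin 2)) n p :=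
  eq_of_sum_choose_mul_pow_eq (gen₁ K) (g := fun n => ∑ p ∈ indexSet n,
    integralTerm (pbwBasis K (Fin 2)) n p) (fun n => by
      rw [sum_choose_bell_mul_pow, sum_choose_integralTerm]) n

theorem integralTerm_mem_wordSpan (n : ℕ) (p : ℕ × (LyndonWord (Fin 2) →₀ ℕ)) :
    integralTerm (pbwBasis K (Fin 2)) n p ∈
      wordSpan K {w | w.count 1 = p.1 + weight (List.count 1) p.2} := by
  have hω := isAdditiveWeight_count (1 : Fin 2)
  have h2 : gen₂ K ∈ wordSpan K {w : List (Fin 2) | w.count 1 = 1} := by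
    rw [gen₂, ← word_singleton]
    exact word_mem_wordSpan (by simp)
  have h := hω.pow_mem h2 p.1
  rw [mul_one] at h
  rw [integralTerm_eq]
  exact Submodule.smul_mem _ _
    (hω.mul_mem h ((isBracketing_lyndonBracket K).orderedProd_mem_wordSpan hω p.2))

theorem partialBell_eq_sum_integralTerm (n k : ℕ) :
    partialBell K n k = ∑ p ∈ partialIndexSet n k, integralTerm (pbwBasis K (Fin 2)) n p := by
  rw [partialBell, homogeneousPart_eq_weightPart, bell_eq_sum_integralTerm, map_sum,
    partialIndexSet, Finset.sum_filter]
  refine Finset.sum_congr rfl fun p hp => ?_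
  rw [weightPart_of_mem k (integralTerm_mem_wordSpan K n p)]
  have h := (mem_indexSet.1 hp).2
  -- Total length `n` and degree `k` in `E₂` already force the condition on the number of letters
  -- `1`.
  rw [weight_length_eq] at h
  refine if_congr ⟨fun hk => ⟨hk, ?_⟩, fun hk => hk.1⟩ rfl rfl
  change weight (List.count 0) p.2 + k = n
  omega

theorem fieldTerm_eq_integralTerm {n : ℕ} (hn : (n.factorial : K) ≠ 0)
    {p : ℕ × (LyndonWord (Fin 2) →₀ ℕ)} (hp : p ∈ indexSet n)
    (b : Module.Basis (LyndonWord (Fin 2) →₀ ℕ) K (FreeAlgebra K (Fin 2))) :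
    fieldTerm b n p = integralTerm b n p := by
  have hdvd := denom_dvd_factorial hp
  -- A divisor of `n!` is nonzero in `K` when `n!` is, which legitimates every division in the term.
  have hd : (denom p : K) ≠ 0 := by
    obtain ⟨c, hc⟩ := hdvd
    rw [hc, Nat.cast_mul] at hn
    exact left_ne_zero_of_mul hn
  rw [fieldTerm, integralTerm, orderedProd_smul, orderedProd_smul, mul_smul_comm, mul_smul_comm,
    smul_smul, smul_smul, Nat.cast_div hdvd hd]
  congr 1
  simp only [denom, Finsupp.prod, div_pow, Finset.prod_div_distrib, Finset.prod_mul_distrib]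
  push_cast
  simp only [div_eq_mul_inv, mul_inv]
  ring

end TwoLetters

end LyndonBell

end

open LyndonBell in
theorem mainTheorem11 (K : Type*) [Field K] :
    ∃ b : Module.Basis (LyndonWord (Fin 2) →₀ ℕ) K (FreeAlgebra K (Fin 2)),
      (∀ t, b t = pbwMonomial K t) ∧
      (∀ n : ℕ, ∀ p ∈ indexSet n, denom p ∣ n.factorial) ∧
      (∀ n k : ℕ, partialBell K n k = ∑ p ∈ partialIndexSet n k, integralTerm b n p) ∧
      (∀ n : ℕ, bell (gen₁ K) (gen₂ K) n = ∑ p ∈ indexSet n, integralTerm b n p) ∧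
      (∀ n : ℕ, (n.factorial : K) ≠ 0 →
        (∀ k : ℕ, partialBell K n k = ∑ p ∈ partialIndexSet n k, fieldTerm b n p) ∧
        bell (gen₁ K) (gen₂ K) n = ∑ p ∈ indexSet n, fieldTerm b n p) := by
  refine ⟨pbwBasis K (Fin 2), pbwBasis_apply K, fun n p => denom_dvd_factorial,
    partialBell_eq_sum_integralTerm K, bell_eq_sum_integralTerm K, fun n hn => ⟨fun k => ?_, ?_⟩⟩
  · rw [partialBell_eq_sum_integralTerm]
    exact Finset.sum_congr rfl fun p hp =>
      (fieldTerm_eq_integralTerm K hn (Finset.mem_filter.1 hp).1 _).symm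
  · rw [bell_eq_sum_integralTerm]
    exact Finset.sum_congr rfl fun p hp => (fieldTerm_eq_integralTerm K hn hp _).symm
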